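/- **Definitions.** Bits are elements of $\mathbb F_2$. An *$l2$-MBQC* with $n$ input bits on an $N$-qubit resource state consists of: a unit vector $|\psi\rangle\in(\mathbb C^2)^{\otimes N}$; for each qubit $k$ and each setting $s\in\mathbb F_2$ a one-qubit observable $O_k(s)$ (Hermitian, $O_k(s)^2=I$, eigenvalues $+1$ and $-1$ each of multiplicity one, the outcome $m_k\in\mathbb F_2$ standing for the eigenvalue $(-1)^{m_k}$); a preprocessing matrix $P\in\mathbb F_2^{N\times n}$; an adaptation matrix $A\in\mathbb F_2^{N\times N}$ that is strictly lower triangular for a suitable ordering of the qubits; a vector $\mathbf o\in\mathbb F_2^N$ and a constant $c\in\mathbb F_2$. On input $\mathbf x\in\mathbb F_2^n$ each qubit $k$ is measured in the eigenbasis of $O_k(s_k)$, where $\mathbf s=P\mathbf x\oplus A\mathbf m$ and $\mathbf m\in\mathbb F_2^N$ is the string of outcomes, and the output is $y=\mathbf o^T\mathbf m\oplus c$. It *computes* $f:\mathbb F_2^n\to\mathbb F_2$ if for every $\mathbf x$ the output equals $f(\mathbf x)$ with probability $1$. The *1D cluster state* on $N$ qubits is $|\mathrm{1DC}_N\rangle=\bigl(\prod_{j=1}^{N-1}\mathrm{C}Z_{j,j+1}\bigr)H^{\otimes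 N}|0\rangle^{\otimes N}$. The resource costs of an $l2$-MBQC are: $L_Q=N$, the number of qubits; $L_C$, the number of distinct nonzero rows of $P$ (the number of different bits of the form $\mathbf p\cdot\mathbf x$, $\mathbf p\ne 0$, that $P$ outputs); $T_C$, the number of rounds in which the measurements are carried out, where every round measures at least one qubit and the settings used in a round depend only on the input and on outcomes of earlier rounds; $T_Q$, the depth of a circuit preparing $|\psi\rangle$ from $|0\rangle^{\otimes N}$, here made of Hadamard gates and $\mathrm{C}Z$ gates between neighbouring qubits of a chain, each layer consisting of at least one gate and all gates of a layer acting on disjoint qubits. **Theorem.** Let $n\ge 1$ and let $f:\mathbb F_2^n\to\mathbb F_2$ be symmetric, i.e. invariant under all permutations of the input bits. Then $f$ is computed by an adaptive $l2$-MBQC whose resource state is the 1D cluster state $|\mathrm{1DC}_{L_Q}\rangle$, with resource costs $$L_C=n,\qquad L_Q=8n^2+10n+1,\qquad T_C=8n+2,\qquad T_Q=3 .$$ -/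

import Mathlib

open scoped Matrix

noncomputable section

namespace QubitMBQC

/-! ### Qubit registers

Vectors of `(ℂ²)^{⊗N}` are given by their coefficients in the computational basis, which is
indexed by bit strings `Fin N → ZMod 2`. -/

/-- Linear operators on one qubit, in the computational basis. -/
abbrev QubitOp := Matrix (ZMod 2) (ZMod 2) ℂ

/-- Vectors of the `N`-qubit space. -/
abbrev RegVec (N : ℕ) := (Fin N → ZMod 2) → ℂ

/-- Linear operators on the `N`-qubit space. -/
abbrev RegOp (N : ℕ) := Matrix (Fin N → ZMod 2) (Fin N → ZMod 2) ℂ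

/-- The sign `(-1)^b` of a bit. -/
def sgn (b : ZMod 2) : ℂ := (-1) ^ b.val

/-- The tensor product `M 0 ⊗ M 1 ⊗ ⋯ ⊗ M (N-1)` of one-qubit operators. -/
def tensorOp {N : ℕ} (M : Fin N → QubitOp) : RegOp N :=
  Matrix.of fun a b => ∏ k, M k (a k) (b k)

/-- The Hadamard operator `(∑_{j,k} (-1)^{jk} |j⟩⟨k|) / √2`. -/
def hadamard : QubitOp := Matrix.of fun j k => sgn (j * k) / (Real.sqrt 2 : ℂ)

/-- The Hadamard operator acting on qubit `j` of a register. -/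
def hadamardOn {N : ℕ} (j : Fin N) : RegOp N :=
  tensorOp (Function.update (fun _ => (1 : QubitOp)) j hadamard)

/-- The controlled-`Z` operator acting on qubits `j` and `k` of a register. -/
def czOn {N : ℕ} (j k : Fin N) : RegOp N := Matrix.diagonal fun a => sgn (a j * a k)

/-- The basis vector `|0⟩^{⊗N}`. -/
def zeroState (N : ℕ) : RegVec N := Pi.single 0 1

/-- The 1D cluster state `(∏_{j} CZ_{j,j+1}) H^{⊗N} |0⟩^{⊗N}` on `N` qubits. -/
def clusterState (N : ℕ) : RegVec N :=
  (((List.finRange (N - 1)).map fun j : Fin (N - 1) =>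
      czOn (⟨j.val, by omega⟩ : Fin N) ⟨j.val + 1, by omega⟩).prod *
    tensorOp fun _ => hadamard) *ᵥ zeroState N

/-! ### Circuits of Hadamard and nearest-neighbour controlled-`Z` gates on a 1D chain -/

/-- A Hadamard gate on one qubit, or a `CZ` gate on two neighbouring qubits `j`, `k = j + 1`. -/
inductive Gate (N : ℕ) where
  | had (j : Fin N) : Gate N
  | cz (j k : Fin N) (h : k.val = j.val + 1) : Gate N

/-- The set of qubits on which a gate acts. -/
def Gate.support {N : ℕ} : Gate N → Finset (Fin N)
  | .had j => {j}
  | .cz j k _ => {j, k}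

/-- The unitary operator of a gate. -/
def Gate.op {N : ℕ} : Gate N → RegOp N
  | .had j => hadamardOn j
  | .cz j k _ => czOn j k

/-- One layer (time step) of a circuit: at least one gate, all acting on disjoint qubits. -/
structure Layer (N : ℕ) where
  gates : List (Gate N)
  nonempty : gates ≠ []
  disjoint : gates.Pairwise fun g h => Disjoint g.support h.support

/-- The unitary operator of a layer (its gates commute, so their order is irrelevant). -/
def Layer.op {N : ℕ} (l : Layer N) : RegOp N := (l.gates.map Gate.op).prod

/-- The vector obtained from `|0⟩^{⊗N}` by applying the layers of a circuit one after the other. -/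
def runCircuit {N : ℕ} (C : List (Layer N)) : RegVec N :=
  C.foldl (fun ψ l => l.op *ᵥ ψ) (zeroState N)

/-- `ψ` is prepared from `|0⟩^{⊗N}` by a circuit of depth `T`. -/
def PreparedInDepth {N : ℕ} (ψ : RegVec N) (T : ℕ) : Prop :=
  ∃ C : List (Layer N), C.length = T ∧ runCircuit C = ψ

/-! ### `l2`-MBQC -/

/-- An `l2`-MBQC with `n` input bits on an `N`-qubit resource state. -/
structure L2MBQC (n N : ℕ) where
  /-- the resource state -/
  state : RegVec N
  state_norm : ∑ a, ‖state a‖ ^ 2 = 1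
  /-- the observable measured on qubit `k` for the setting `s` -/
  obs : Fin N → ZMod 2 → QubitOp
  obs_isHermitian : ∀ k s, (obs k s).IsHermitian
  obs_sq : ∀ k s, obs k s * obs k s = 1
  /-- the eigenvalues are `1` and `-1`, each once, so that the measurement is in a basis -/
  obs_trace : ∀ k s, (obs k s).trace = 0
  /-- the preprocessing matrix `P` -/
  pre : Matrix (Fin N) (Fin n) (ZMod 2)
  /-- the adaptation matrix `A` -/
  adapt : Matrix (Fin N) (Fin N) (ZMod 2)
  /-- `A` is (strictly) lower triangular for a suitable ordering of the qubits -/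
  adapt_lower : ∃ σ : Equiv.Perm (Fin N), ∀ k j, adapt k j ≠ 0 → σ j < σ k
  /-- the vector `o` of the outcomes that enter the output -/
  outMask : Fin N → ZMod 2
  /-- the constant `c` of the output -/
  outConst : ZMod 2

namespace L2MBQC

variable {n N : ℕ}

/-- The settings `s = P x ⊕ A m` for the input `x` and the outcomes `m`. -/
def setting (M : L2MBQC n N) (x : Fin n → ZMod 2) (m : Fin N → ZMod 2) : Fin N → ZMod 2 :=
  M.pre *ᵥ x + M.adapt *ᵥ m

/-- The projection `(1 + (-1)^b O_k(s)) / 2` onto the eigenspace of outcome `b`. -/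
def proj (M : L2MBQC n N) (k : Fin N) (s b : ZMod 2) : QubitOp :=
  (1 / 2 : ℂ) • (1 + sgn b • M.obs k s)

/-- The Born probability that the adaptive measurement on input `x` gives the outcomes `m`. -/
def outcomeProb (M : L2MBQC n N) (x : Fin n → ZMod 2) (m : Fin N → ZMod 2) : ℝ :=
  ∑ a, ‖(tensorOp (fun k => M.proj k (M.setting x m k) (m k)) *ᵥ M.state) a‖ ^ 2

/-- The computational output `y = oᵀ m ⊕ c`. -/
def output (M : L2MBQC n N) (m : Fin N → ZMod 2) : ZMod 2 := M.outMask ⬝ᵥ m + M.outConst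

/-- On every input `x`, the output is `f x` with probability one. -/
def Computes (M : L2MBQC n N) (f : (Fin n → ZMod 2) → ZMod 2) : Prop :=
  ∀ x, ∑ m with M.output m = f x, M.outcomeProb x m = 1

/-- The number of different bits (nonzero linear functionals of the input) that `P` outputs. -/
def numClassicalBits (M : L2MBQC n N) : ℕ := ((Finset.univ.image fun k => M.pre k).erase 0).card

/-- The measurements are carried out in exactly `T` rounds: in each round at least one qubit is
measured, and the settings used in a round depend only on outcomes of earlier rounds. -/
def RunsInRounds (M : L2MBQC n N) (T : ℕ) : Prop :=
  ∃ round : Fin N → Fin T, Function.Surjective round ∧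
    ∀ k j, M.adapt k j ≠ 0 → round j < round k

end L2MBQC

/-- Boolean functions that are invariant under permutations of the input bits. -/
def IsSymmetricFn {n : ℕ} (f : (Fin n → ZMod 2) → ZMod 2) : Prop :=
  ∀ (σ : Equiv.Perm (Fin n)) (x : Fin n → ZMod 2), f (x ∘ σ) = f x

end QubitMBQC

end

/-! A symmetric function depends only on the Hamming weight k of the input, so only n + 1 cases have
to be told apart. Measuring a cluster chain in the XY plane drives one logical qubit: each measured
qubit contributes a z rotation and a Hadamard, up to a byproduct X^A Z^B whose exponents are
parities of outcomes. Flipping the sign of the angle compensates X^A, which a linear adaptation can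
do, and the last X is undone by the output mask (`transfer_byproduct`). When rotations by φ
(-1)^(x_i) alternate with zero-angle qubits, the Hadamards cancel in pairs and the angles add up to
φ (n - 2k) (`transfer_signal`). The chain thus performs quantum signal processing: rotations by the
signal n - 2k interleaved with free z and x rotations.

For φ = π / (n + 1) the numbers exp(iφ(n - 2k)) are equidistributed on the unit circle and avoid -1;
a Cayley transform moves them to real nodes t_k. The kernels `fejer` have degree at most n, vanish
at all nodes but their own, and their squared moduli add up to (1 + t²)^n. Grouping them by the
value of the function and taking a Fejér–Riesz square root of each group gives polynomials h_0, h_1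
with |h_0|² + |h_1|² = (1 + t²)^n, where the one belonging to the wrong answer vanishes at t_k
(`exists_interpolating_pair`).

Every such polynomial vector is reachable. The vectors h(i) and h(-i) are orthogonal, so a rotation
makes the components divisible by 1 + ix and 1 - ix; dividing removes one signal rotation and lowers
the degree (`exists_strip`, `realizable_of_eval`). This takes n + 2 blocks, and trivial blocks fill
up the 4n available. The amplitude of the wrong output is then zero, and conservation of the norm
gives the right one probability 1. -/

noncomputable section

namespace QubitMBQC

section SignalProcessing

open Polynomial

/-! ### Nonnegative polynomials as squared absolute values -/

/-- A real polynomial that is nonnegative on the line is the squared absolute value of a complex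
polynomial of half its degree. -/
theorem exists_normSq_eq_of_nonneg (p : ℝ[X]) (hp : ∀ x, 0 ≤ p.eval x) :
    ∃ h : ℂ[X], 2 * h.natDegree ≤ p.natDegree ∧ ∀ x : ℝ, ‖h.eval (x : ℂ)‖ ^ 2 = p.eval x := by
  induction hd : p.natDegree using Nat.strong_induction_on generalizing p with
  | _ d ih =>
  subst hd
  by_cases h0 : p.natDegree = 0
  · rw [eq_C_of_natDegree_eq_zero h0] at hp ⊢
    refine ⟨C ((Real.sqrt (p.coeff 0) : ℝ) : ℂ), by simp, fun x => ?_⟩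
    have := hp 0
    simp only [eval_C] at this
    simp [Real.sq_sqrt this]
  have hp0 : p ≠ 0 := by rintro rfl; simp at h0
  obtain ⟨z, hz⟩ := Complex.exists_root (f := p.map (algebraMap ℝ ℂ))
    (by rw [degree_map]; exact natDegree_pos_iff_degree_pos.1 (Nat.pos_of_ne_zero h0))
  have hz' : aeval z p = 0 := by
    rw [IsRoot.def, eval_map] at hz
    exact hz
  by_cases him : z.im = 0
  · have hzr : z = (z.re : ℂ) := by apply Complex.ext <;> simp [him]
    set a := z.re with ha
    have hra : p.IsRoot a := by
      rw [hzr] at hz'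
      have : aeval (algebraMap ℝ ℂ a) p = 0 := hz'
      rw [aeval_algebraMap_apply] at this
      simpa using this
    obtain ⟨r, hr⟩ := dvd_iff_isRoot.2 hra
    -- A real root has even multiplicity: `r` is nonnegative right of `a` and nonpositive left of
    -- it, hence vanishes at `a`.
    have hc1 : Set.Ici a ⊆ {x | 0 ≤ r.eval x} := by
      rw [← closure_Ioi]
      refine closure_minimal (fun x hx => ?_) (isClosed_le continuous_const r.continuous)
      have h1 := hp x
      rw [hr] at h1
      simp only [eval_mul, eval_sub, eval_X, eval_C] at h1
      exact nonneg_of_mul_nonneg_right h1 (sub_pos.2 hx)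
    have hc2 : Set.Iic a ⊆ {x | r.eval x ≤ 0} := by
      rw [← closure_Iio]
      refine closure_minimal (fun x hx => ?_) (isClosed_le r.continuous continuous_const)
      have h1 := hp x
      rw [hr] at h1
      simp only [eval_mul, eval_sub, eval_X, eval_C] at h1
      have : x - a < 0 := sub_neg.2 hx
      by_contra hcon
      simp only [Set.mem_ofPred_eq, not_le] at hcon
      exact absurd h1 (not_le.2 (mul_neg_of_neg_of_pos this hcon))
    have hrr : r.IsRoot a :=
      le_antisymm (hc2 (Set.mem_Iic.2 le_rfl)) (hc1 (Set.mem_Ici.2 le_rfl))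
    obtain ⟨s, hs⟩ := dvd_iff_isRoot.2 hrr
    have hps : p = (X - C a) ^ 2 * s := by rw [hr, hs]; ring
    have hs0 : s ≠ 0 := by rintro rfl; simp [hps] at hp0
    have hsn : ∀ x, 0 ≤ s.eval x := by
      have hd : Dense ({a}ᶜ : Set ℝ) := dense_compl_singleton a
      have hcl : IsClosed {x | 0 ≤ s.eval x} := isClosed_le continuous_const s.continuous
      intro x
      refine closure_minimal (fun y hy => ?_) hcl (hd x)
      have h1 := hp y
      rw [hps] at h1
      simp only [eval_mul, eval_sub, eval_X, eval_C, eval_pow] at h1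
      have : y - a ≠ 0 := sub_ne_zero.2 hy
      exact nonneg_of_mul_nonneg_right h1 (by positivity)
    have hdeg : p.natDegree = 2 + s.natDegree := by
      rw [hps, natDegree_mul (pow_ne_zero _ (X_sub_C_ne_zero a)) hs0, natDegree_pow,
        natDegree_X_sub_C]
    obtain ⟨h, h1, h2⟩ := ih s.natDegree (by omega) s hsn rfl
    refine ⟨(X - C (a : ℂ)) * h, ?_, fun x => ?_⟩
    · have := natDegree_mul_le (p := X - C (a : ℂ)) (q := h)
      rw [natDegree_X_sub_C] at this
      omega
    · rw [hps]
      simp only [eval_mul, eval_sub, eval_X, eval_C, eval_pow, norm_mul, mul_pow, h2]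
      rw [← Complex.ofReal_sub, Complex.norm_real, Real.norm_eq_abs, sq_abs]
  · obtain ⟨s, hps⟩ := quadratic_dvd_of_aeval_eq_zero_im_ne_zero p hz' him
    -- On the real line the quadratic factor of a conjugate pair of roots is the squared modulus of
    -- one linear factor.
    have hq : ∀ x : ℝ, ‖(x : ℂ) - z‖ ^ 2 = x ^ 2 - 2 * z.re * x + ‖z‖ ^ 2 := by
      intro x
      simp only [Complex.sq_norm, Complex.normSq_apply, Complex.sub_re, Complex.sub_im,
        Complex.ofReal_re, Complex.ofReal_im]
      ring
    have hev : ∀ x : ℝ, p.eval x = ‖(x : ℂ) - z‖ ^ 2 * s.eval x := by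
      intro x
      rw [hq, hps]
      simp
    have hs0 : s ≠ 0 := by rintro rfl; simp [hps] at hp0
    have hsn : ∀ x, 0 ≤ s.eval x := by
      intro x
      have h1 := hp x
      rw [hev] at h1
      have : (x : ℂ) - z ≠ 0 := fun h => him (by rw [← sub_eq_zero.1 h]; simp)
      exact nonneg_of_mul_nonneg_right h1 (by positivity)
    have hqd : (X ^ 2 - C (2 * z.re) * X + C (‖z‖ ^ 2) : ℝ[X]).natDegree = 2 := by
      compute_degree!
    have hdeg : p.natDegree = 2 + s.natDegree := by
      rw [hps, natDegree_mul (fun h => by rw [h] at hqd; simp at hqd) hs0, hqd]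
    obtain ⟨h, h1, h2⟩ := ih s.natDegree (by omega) s hsn rfl
    refine ⟨(X - C z) * h, ?_, fun x => ?_⟩
    · have := natDegree_mul_le (p := X - C z) (q := h)
      rw [natDegree_X_sub_C] at this
      omega
    · rw [hev]
      simp only [eval_mul, eval_sub, eval_X, eval_C, norm_mul, mul_pow, h2]

theorem exists_real_eval_eq_normSq (h : ℂ[X]) (d : ℕ) (hd : h.natDegree ≤ d) :
    ∃ r : ℝ[X], r.natDegree ≤ 2 * d ∧ ∀ x : ℝ, r.eval x = ‖h.eval (x : ℂ)‖ ^ 2 := by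
  let part (F : ℂ → ℝ) : ℝ[X] := ∑ i ∈ Finset.range (d + 1), C (F (h.coeff i)) * X ^ i
  have hpart : ∀ F, (part F).natDegree ≤ d := fun F =>
    natDegree_sum_le_of_forall_le _ _ fun i hi =>
      (natDegree_C_mul_X_pow_le _ _).trans (Nat.lt_succ_iff.1 (Finset.mem_range.1 hi))
  have hsum : ∀ x : ℝ, h.eval (x : ℂ) = ∑ i ∈ Finset.range (d + 1), h.coeff i * (x : ℂ) ^ i :=
    fun x => eval_eq_sum_range' (Nat.lt_succ_iff.2 hd) _
  refine ⟨part Complex.re ^ 2 + part Complex.im ^ 2, ?_, fun x => ?_⟩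
  · refine (natDegree_add_le _ _).trans (max_le ?_ ?_) <;>
    exact natDegree_pow_le.trans (Nat.mul_le_mul_left _ (hpart _))
  · have h1 : (part Complex.re).eval x = (h.eval (x : ℂ)).re := by
      simp only [hsum, part, eval_finsetSum, Complex.re_sum]
      refine Finset.sum_congr rfl fun i _ => ?_
      rw [← Complex.ofReal_pow, Complex.re_mul_ofReal]; simp
    have h2 : (part Complex.im).eval x = (h.eval (x : ℂ)).im := by
      simp only [hsum, part, eval_finsetSum, Complex.im_sum]
      refine Finset.sum_congr rfl fun i _ => ?_
      rw [← Complex.ofReal_pow, Complex.im_mul_ofReal]; simp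
    rw [eval_add, eval_pow, eval_pow, h1, h2, Complex.sq_norm, Complex.normSq_apply]
    ring

/-- A finite sum of squared absolute values of complex polynomials is again one. -/
theorem exists_normSq_eq_sum {ι : Type*} (s : Finset ι) (h : ι → ℂ[X]) (d : ℕ)
    (hd : ∀ i ∈ s, (h i).natDegree ≤ d) :
    ∃ q : ℂ[X], q.natDegree ≤ d ∧
      ∀ x : ℝ, ‖q.eval (x : ℂ)‖ ^ 2 = ∑ i ∈ s, ‖(h i).eval (x : ℂ)‖ ^ 2 := by
  have hr : ∀ i, ∃ r : ℝ[X], i ∈ s →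
      r.natDegree ≤ 2 * d ∧ ∀ x : ℝ, r.eval x = ‖(h i).eval (x : ℂ)‖ ^ 2 := by
    intro i
    by_cases hi : i ∈ s
    · obtain ⟨r, h⟩ := exists_real_eval_eq_normSq (h i) d (hd i hi)
      exact ⟨r, fun _ => h⟩
    · exact ⟨0, fun h => absurd h hi⟩
  choose r hr using hr
  have hev : ∀ x, (∑ i ∈ s, r i).eval x = ∑ i ∈ s, ‖(h i).eval (x : ℂ)‖ ^ 2 := fun x => by
    rw [eval_finsetSum]
    exact Finset.sum_congr rfl fun i hi => (hr i hi).2 x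
  obtain ⟨q, h1, h2⟩ := exists_normSq_eq_of_nonneg (∑ i ∈ s, r i)
    (fun x => by rw [hev]; positivity)
  refine ⟨q, ?_, fun x => (h2 x).trans (hev x)⟩
  have : (∑ i ∈ s, r i).natDegree ≤ 2 * d :=
    natDegree_sum_le_of_forall_le _ _ fun i hi => (hr i hi).1
  omega

/-! ### Fejér interpolation on equidistributed nodes -/

/-- The Fejér node `exp (π i (n - 2 k) / (n + 1))` on the unit circle. -/
def node (n : ℕ) (k : ℤ) : ℂ := Complex.exp ((Real.pi * (n - 2 * k) / (n + 1) : ℝ) * Complex.I)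

/-- The coordinate of a Fejér node on the real line. -/
def realNode (n : ℕ) (k : ℤ) : ℝ := Real.tan (Real.pi * (n - 2 * k) / (n + 1) / 2)

theorem sum_pow_exp_eq_zero (n : ℕ) (d : ℤ) (hd : ¬ ((n + 1 : ℕ) : ℤ) ∣ d) :
    ∑ k ∈ Finset.range (n + 1),
      Complex.exp (2 * Real.pi * Complex.I * (d / (n + 1 : ℂ))) ^ k = 0 := by
  set ρ := Complex.exp (2 * Real.pi * Complex.I * (d / (n + 1 : ℂ))) with hρ
  have hn : (n + 1 : ℂ) ≠ 0 := by exact_mod_cast Nat.succ_ne_zero n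
  have h1 : ρ ≠ 1 := by
    intro h
    obtain ⟨m, hm⟩ := Complex.exp_eq_one_iff.1 h
    apply hd
    refine ⟨m, ?_⟩
    have h2 : (d : ℂ) / (n + 1) = m := by
      have := Complex.two_pi_I_ne_zero
      have h3 : 2 * Real.pi * Complex.I * (d / (n + 1 : ℂ)) = 2 * Real.pi * Complex.I * m := by
        rw [hm]; ring
      exact mul_left_cancel₀ this h3
    rw [div_eq_iff hn] at h2
    have : (d : ℂ) = ((((n + 1 : ℕ) : ℤ) * m : ℤ) : ℂ) := by rw [h2]; push_cast; ring
    exact_mod_cast this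
  have h2 : ρ ^ (n + 1) = 1 := by
    rw [hρ, ← Complex.exp_nat_mul]
    refine Complex.exp_eq_one_iff.2 ⟨d, ?_⟩
    push_cast
    field_simp
  rw [geom_sum_eq h1, h2]
  simp

theorem conj_node (n : ℕ) (k : ℤ) : (starRingEnd ℂ) (node n k) = (node n k)⁻¹ := by
  rw [node, ← Complex.exp_conj, ← Complex.exp_neg]
  rw [map_mul, Complex.conj_ofReal, Complex.conj_I, mul_neg]

theorem node_ne_zero (n : ℕ) (k : ℤ) : node n k ≠ 0 := Complex.exp_ne_zero _

theorem node_mul_inv_node (n : ℕ) (j k : ℤ) : node n j * (node n k)⁻¹ =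
    Complex.exp (2 * Real.pi * Complex.I * (((k - j : ℤ) : ℂ) / (n + 1 : ℂ))) := by
  have hn : (n + 1 : ℂ) ≠ 0 := by exact_mod_cast Nat.succ_ne_zero n
  rw [node, node, ← Complex.exp_neg, ← Complex.exp_add]
  congr 1
  push_cast
  field_simp
  ring

/-- The Fejér kernel centred at the node `k`, in the coordinate of the real line. -/
def fejer (n : ℕ) (k : ℤ) : ℂ[X] :=
  C ((n + 1 : ℂ)⁻¹) * ∑ m ∈ Finset.range (n + 1),
    C ((node n k)⁻¹ ^ m) * ((1 + C Complex.I * X) ^ m * (1 - C Complex.I * X) ^ (n - m))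

theorem natDegree_fejer_le (n : ℕ) (k : ℤ) : (fejer n k).natDegree ≤ n := by
  refine (natDegree_C_mul_le _ _).trans (natDegree_sum_le_of_forall_le _ _ fun m hm => ?_)
  refine (natDegree_C_mul_le _ _).trans (natDegree_mul_le.trans ?_)
  have h1 : (1 + C Complex.I * X : ℂ[X]).natDegree ≤ 1 := by compute_degree
  have h2 : (1 - C Complex.I * X : ℂ[X]).natDegree ≤ 1 := by compute_degree
  have h3 := natDegree_pow_le_of_le m h1
  have h4 := natDegree_pow_le_of_le (n - m) h2
  have := Finset.mem_range.1 hm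
  omega

/-- The Cayley transform: 1 ± i tan θ = exp(± iθ) / cos θ, and |n - 2k| < n + 1 keeps the half angle
θ inside (-π/2, π/2). -/
theorem one_add_realNode (n k : ℕ) (hk : k ≤ n) :
    (1 + Complex.I * realNode n k) = node n k * (1 - Complex.I * realNode n k) ∧
      1 - Complex.I * realNode n k ≠ 0 := by
  set θ : ℝ := Real.pi * (n - 2 * (k : ℤ)) / (n + 1) / 2 with hθ
  have hkn : (k : ℝ) ≤ n := by exact_mod_cast hk
  have hk0 : (0 : ℝ) ≤ k := by positivity
  have hcos : Real.cos θ ≠ 0 := by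
    refine (Real.cos_pos_of_mem_Ioo ⟨?_, ?_⟩).ne'
    · rw [hθ, div_div, lt_div_iff₀ (by positivity)]
      push_cast
      nlinarith [Real.pi_pos]
    · rw [hθ, div_div, div_lt_iff₀ (by positivity)]
      push_cast
      nlinarith [Real.pi_pos]
  have hc : (Real.cos θ : ℂ) ≠ 0 := by exact_mod_cast hcos
  have ht : (realNode n k : ℂ) = Real.sin θ / Real.cos θ := by
    rw [realNode, ← hθ, Real.tan_eq_sin_div_cos]; push_cast; rfl
  have h1 : (Real.cos θ : ℂ) * (1 + Complex.I * realNode n k) = Complex.exp (θ * Complex.I) := by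
    rw [Complex.exp_mul_I, ht]; push_cast at hc ⊢; field_simp
  have h2 : (Real.cos θ : ℂ) * (1 - Complex.I * realNode n k) =
      Complex.exp (-(θ * Complex.I)) := by
    rw [← neg_mul, Complex.exp_mul_I, ht, Complex.cos_neg, Complex.sin_neg]
    push_cast at hc ⊢; field_simp; ring
  refine ⟨mul_left_cancel₀ hc ?_, fun h => ?_⟩
  · rw [h1, mul_left_comm, h2, node, ← Complex.exp_add]
    congr 1
    rw [hθ]; push_cast; ring
  · rw [h, mul_zero] at h2
    exact Complex.exp_ne_zero _ h2.symm

/-- At a node the kernel becomes a full geometric sum over powers of a quotient of two nodes, which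
is a nontrivial (n + 1)-th root of unity. -/
theorem eval_fejer_realNode (n j k : ℕ) (hj : j ≤ n) (hk : k ≤ n) (hjk : j ≠ k) :
    (fejer n k).eval (realNode n j : ℂ) = 0 := by
  obtain ⟨h1, -⟩ := one_add_realNode n j hj
  have : ∀ m ∈ Finset.range (n + 1), (node n k)⁻¹ ^ m * ((1 + Complex.I * realNode n j) ^ m *
      (1 - Complex.I * realNode n j) ^ (n - m)) =
      (1 - Complex.I * realNode n j) ^ n * (node n j * (node n k)⁻¹) ^ m := by
    intro m hm
    have h2 : (1 - Complex.I * realNode n j) ^ n =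
        (1 - Complex.I * realNode n j) ^ m * (1 - Complex.I * realNode n j) ^ (n - m) := by
      rw [← pow_add, Nat.add_sub_cancel' (Nat.lt_succ_iff.1 (Finset.mem_range.1 hm))]
    rw [h1, h2]; simp only [mul_pow]; ring
  simp only [fejer, eval_mul, eval_C, eval_finsetSum, eval_pow, eval_add, eval_sub, eval_one,
    eval_X]
  rw [Finset.sum_congr rfl this, ← Finset.mul_sum, node_mul_inv_node, sum_pow_exp_eq_zero]
  · simp
  · intro h
    apply hjk
    have h4 := Int.eq_zero_of_abs_lt_dvd h (by rw [abs_lt]; constructor <;> push_cast <;> omega)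
    omega

/-- Parseval for the discrete Fourier transform: summing over the nodes kills the cross terms, and
each of the n + 1 diagonal terms has the same modulus (1 + t²)^n. -/
theorem sum_normSq_fejer (n : ℕ) (t : ℝ) :
    ∑ k ∈ Finset.range (n + 1), ‖(fejer n k).eval (t : ℂ)‖ ^ 2 = (1 + t ^ 2) ^ n := by
  have hn : (n + 1 : ℂ) ≠ 0 := by exact_mod_cast Nat.succ_ne_zero n
  let c : ℕ → ℂ := fun m => (1 + Complex.I * t) ^ m * (1 - Complex.I * t) ^ (n - m)
  let cb : ℕ → ℂ := fun m => (1 - Complex.I * t) ^ m * (1 + Complex.I * t) ^ (n - m)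
  have hc : ∀ m ∈ Finset.range (n + 1), c m * cb m = (1 + (t : ℂ) ^ 2) ^ n := by
    intro m hm
    have h1 : n = m + (n - m) := by have := Finset.mem_range.1 hm; omega
    have h2 : (1 + (t : ℂ) ^ 2) = (1 + Complex.I * t) * (1 - Complex.I * t) := by
      ring_nf; simp
    conv_rhs => rw [h1, h2, pow_add]
    simp only [c, cb, mul_pow]
    ring
  have hev : ∀ k : ℕ, (fejer n k).eval (t : ℂ) =
      (n + 1 : ℂ)⁻¹ * ∑ m ∈ Finset.range (n + 1), (node n k)⁻¹ ^ m * c m := by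
    intro k
    simp only [fejer, eval_mul, eval_C, eval_finsetSum, eval_pow, eval_add, eval_sub, eval_one,
      eval_X, c]
  have hcj : ∀ k : ℕ, (starRingEnd ℂ) ((fejer n k).eval (t : ℂ)) =
      (n + 1 : ℂ)⁻¹ * ∑ m ∈ Finset.range (n + 1), node n k ^ m * cb m := by
    intro k
    rw [hev, map_mul, map_sum]
    congr 1
    · simp
    · refine Finset.sum_congr rfl fun m _ => ?_
      simp only [map_mul, map_pow, map_inv₀, conj_node, inv_inv, c, cb, map_add, map_sub, map_one,
        Complex.conj_I, Complex.conj_ofReal]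
      congr 2 <;> ring
  -- Orthogonality of the characters on the nodes; the offset of the nodes from the roots of unity
  -- comes out as the constant factor with base `node n 0`.
  have key : ∀ m ∈ Finset.range (n + 1), ∀ l ∈ Finset.range (n + 1),
      ∑ k ∈ Finset.range (n + 1), (node n k)⁻¹ ^ m * node n k ^ l =
        if m = l then (n + 1 : ℂ) else 0 := by
    intro m hm l hl
    split_ifs with hml
    · subst hml
      rw [Finset.sum_congr rfl fun k _ => by
        rw [← mul_pow, inv_mul_cancel₀ (node_ne_zero n k), one_pow]]
      simp
    · have h1 : ∀ k : ℕ, (node n k)⁻¹ ^ m * node n k ^ l = node n 0 ^ ((l : ℤ) - m) *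
          Complex.exp (2 * Real.pi * Complex.I * (((m - l : ℤ) : ℂ) / (n + 1 : ℂ))) ^ k := by
        intro k
        rw [node, node, ← Complex.exp_neg, ← Complex.exp_nat_mul, ← Complex.exp_nat_mul,
          ← Complex.exp_nat_mul, ← Complex.exp_int_mul, ← Complex.exp_add, ← Complex.exp_add]
        congr 1
        push_cast
        field_simp
        ring
      rw [Finset.sum_congr rfl fun k _ => h1 k, ← Finset.mul_sum, sum_pow_exp_eq_zero, mul_zero]
      intro h
      apply hml
      rw [Finset.mem_range] at hm hl
      have h4 := Int.eq_zero_of_abs_lt_dvd h (by rw [abs_lt]; constructor <;> push_cast <;> omega)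
      omega
  have : ((∑ k ∈ Finset.range (n + 1), ‖(fejer n k).eval (t : ℂ)‖ ^ 2 : ℝ) : ℂ) =
      (((1 + t ^ 2) ^ n : ℝ) : ℂ) := by
    push_cast
    have h1 : ∀ k ∈ Finset.range (n + 1), (‖(fejer n k).eval (t : ℂ)‖ : ℂ) ^ 2 =
        (n + 1 : ℂ)⁻¹ ^ 2 * ∑ m ∈ Finset.range (n + 1), ∑ l ∈ Finset.range (n + 1),
          c m * cb l * ((node n k)⁻¹ ^ m * node n k ^ l) := by
      intro k _
      rw [← Complex.mul_conj', hcj, hev, mul_mul_mul_comm, Finset.sum_mul_sum, ← sq]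
      congr 1
      refine Finset.sum_congr rfl fun m _ => Finset.sum_congr rfl fun l _ => ?_
      ring
    rw [Finset.sum_congr rfl h1, ← Finset.mul_sum, Finset.sum_comm]
    rw [Finset.sum_congr rfl fun m _ => Finset.sum_comm]
    rw [Finset.sum_congr rfl fun m hm => Finset.sum_congr rfl fun l hl => by
      rw [← Finset.mul_sum, key m hm l hl]]
    rw [Finset.sum_congr rfl fun m hm => by
      rw [Finset.sum_congr rfl fun l _ => mul_ite _ _ _ _, Finset.sum_congr rfl fun l _ => by
        rw [mul_zero], Finset.sum_ite_eq, if_pos hm, hc m hm]]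
    rw [Finset.sum_const, Finset.card_range, nsmul_eq_mul]
    push_cast
    field_simp
  exact_mod_cast this

/-- Two polynomials that share the weight `(1 + t²)ⁿ` and of which exactly one vanishes at each
node, as prescribed by `g`. -/
theorem exists_interpolating_pair (n : ℕ) (g : ℕ → ZMod 2) :
    ∃ h : ZMod 2 → ℂ[X], (∀ a, (h a).natDegree ≤ n) ∧
      (∀ t : ℝ, ∑ a, ‖(h a).eval (t : ℂ)‖ ^ 2 = (1 + t ^ 2) ^ n) ∧
      ∀ k ≤ n, (h (g k + 1)).eval (realNode n k : ℂ) = 0 := by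
  have h1 : ∀ a, ∃ q : ℂ[X], q.natDegree ≤ n ∧ ∀ x : ℝ, ‖q.eval (x : ℂ)‖ ^ 2 =
      ∑ k ∈ Finset.range (n + 1) with g k = a, ‖(fejer n k).eval (x : ℂ)‖ ^ 2 := fun a =>
    exists_normSq_eq_sum _ (fun k : ℕ => fejer n k) n fun k _ => natDegree_fejer_le n k
  choose h hd hev using h1
  refine ⟨h, hd, fun t => ?_, fun k hk => ?_⟩
  · simp only [hev]
    rw [← sum_normSq_fejer, Finset.sum_fiberwise]
  · have : ‖(h (g k + 1)).eval (realNode n k : ℂ)‖ ^ 2 = 0 := by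
      rw [hev]
      refine Finset.sum_eq_zero fun j hj => ?_
      rw [Finset.mem_filter, Finset.mem_range] at hj
      have hjk : k ≠ j := by
        rintro rfl
        simpa using hj.2
      rw [eval_fejer_realNode n k j hk (by omega) hjk]
      simp
    simpa using this

/-! ### Signal processing on one qubit -/

theorem sum_bit {M : Type*} [AddCommMonoid M] (F : ZMod 2 → M) : ∑ a, F a = F 0 + F 1 :=
  Fin.sum_univ_two F

theorem forall_bit {p : ZMod 2 → Prop} : (∀ a, p a) ↔ p 0 ∧ p 1 :=
  Fin.forall_fin_two

@[simp] theorem sgn_zero : sgn 0 = 1 := by simp [sgn]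

@[simp] theorem sgn_one : sgn 1 = -1 := by simp [sgn, ZMod.val_one]

/-- The unnormalized Hadamard transform of a one-qubit vector. -/
def had (v : ZMod 2 → ℂ) : ZMod 2 → ℂ := fun b => ∑ a, sgn (a * b) * v a

/-- The diagonal of the rotation `diag (1, exp (-i θ))`. -/
def phaseVec (θ : ℝ) : ZMod 2 → ℂ := fun a => if a = 0 then 1 else Complex.exp (-(θ * Complex.I))

@[simp] theorem phaseVec_apply_zero (θ : ℝ) : phaseVec θ 0 = 1 := by simp [phaseVec]

@[simp] theorem phaseVec_apply_one (θ : ℝ) :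
    phaseVec θ 1 = Complex.exp (-(θ * Complex.I)) := by simp [phaseVec]

@[simp] theorem phaseVec_zero : phaseVec 0 = 1 := by
  funext a
  simp [phaseVec]

theorem phaseVec_add (θ η : ℝ) : phaseVec (θ + η) = phaseVec θ * phaseVec η := by
  funext a
  by_cases ha : a = 0
  · simp [phaseVec, ha]
  · simp only [phaseVec, ha, if_false, Pi.mul_apply, ← Complex.exp_add]
    congr 1
    push_cast
    ring

theorem had_smul (c : ℂ) (v : ZMod 2 → ℂ) : had (c • v) = c • had v := by
  funext b
  simp only [had, Pi.smul_apply, smul_eq_mul, Finset.mul_sum]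
  exact Finset.sum_congr rfl fun a _ => by ring

theorem had_apply_zero (v : ZMod 2 → ℂ) : had v 0 = v 0 + v 1 := by
  simp [had, sum_bit]

theorem had_apply_one (v : ZMod 2 → ℂ) : had v 1 = v 0 - v 1 := by
  simp [had, sum_bit, sub_eq_add_neg]

theorem had_had (v : ZMod 2 → ℂ) : had (had v) = (2 : ℂ) • v := by
  funext b
  revert b
  rw [forall_bit]
  constructor <;> simp only [had_apply_zero, had_apply_one, Pi.smul_apply, smul_eq_mul] <;> ring

/-- The (unnormalized) state after `j` blocks, each of which consists of a signal rotation
`φ τ` and a rotation `ζ` about the `z` axis followed by a rotation `ξ` about the `x` axis. -/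
def blockState (φ ζ ξ : ℕ → ℝ) (τ : ℝ) : ℕ → ZMod 2 → ℂ
  | 0 => 1
  | j + 1 => had (phaseVec (ξ j) * had (phaseVec (ζ j) *
      (phaseVec (φ j * τ) * blockState φ ζ ξ τ j)))

theorem blockState_congr {φ ζ ξ φ' ζ' ξ' : ℕ → ℝ} (τ : ℝ) (j : ℕ)
    (h : ∀ i < j, φ i = φ' i ∧ ζ i = ζ' i ∧ ξ i = ξ' i) :
    blockState φ ζ ξ τ j = blockState φ' ζ' ξ' τ j := by
  induction j with
  | zero => rfl
  | succ j ih =>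
    obtain ⟨h1, h2, h3⟩ := h j (Nat.lt_succ_self j)
    rw [blockState, blockState, ih fun i hi => h i (Nat.lt_succ_of_lt hi), h1, h2, h3]

/-- A family of vectors is reached, up to nonzero factors, after `j` blocks. -/
def Realizable {K : Type*} (τ : K → ℝ) (j : ℕ) (v : K → ZMod 2 → ℂ) : Prop :=
  ∃ φ ζ ξ : ℕ → ℝ, ∀ κ, ∃ c : ℂ, c ≠ 0 ∧ blockState φ ζ ξ (τ κ) j = c • v κ

namespace Realizable

variable {K : Type*} {τ : K → ℝ}

theorem congr {j : ℕ} {v w : K → ZMod 2 → ℂ} (h : Realizable τ j v)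
    (hvw : ∀ κ, ∃ c : ℂ, c ≠ 0 ∧ v κ = c • w κ) : Realizable τ j w := by
  obtain ⟨φ, ζ, ξ, h⟩ := h
  refine ⟨φ, ζ, ξ, fun κ => ?_⟩
  obtain ⟨c, hc, h1⟩ := h κ
  obtain ⟨c', hc', h2⟩ := hvw κ
  exact ⟨c * c', mul_ne_zero hc hc', by rw [h1, h2, smul_smul]⟩

theorem step {j : ℕ} {v : K → ZMod 2 → ℂ} (h : Realizable τ j v) (p z x : ℝ) :
    Realizable τ (j + 1) fun κ =>
      had (phaseVec x * had (phaseVec z * (phaseVec (p * τ κ) * v κ))) := by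
  obtain ⟨φ, ζ, ξ, h⟩ := h
  refine ⟨Function.update φ j p, Function.update ζ j z, Function.update ξ j x, fun κ => ?_⟩
  obtain ⟨c, hc, h1⟩ := h κ
  refine ⟨c, hc, ?_⟩
  have h2 : blockState (Function.update φ j p) (Function.update ζ j z) (Function.update ξ j x)
      (τ κ) j = c • v κ := by
    rw [← h1]
    refine blockState_congr _ _ fun i hi => ?_
    simp [Function.update_of_ne hi.ne]
  rw [blockState, h2]
  simp only [Function.update_self, mul_smul_comm, had_smul]

theorem pad {j : ℕ} {v : K → ZMod 2 → ℂ} (h : Realizable τ j v) {m : ℕ} (hm : j ≤ m) :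
    Realizable τ m v := by
  induction m, hm using Nat.le_induction with
  | base => exact h
  | succ m _ ih =>
    refine (ih.step 0 0 0).congr fun κ => ⟨2, two_ne_zero, ?_⟩
    simp only [zero_mul, phaseVec_zero, one_mul, had_had]

end Realizable

/-! ### Synthesis of polynomial vectors by signal rotations -/

theorem had_phaseVec_had (x : ℝ) (u : ZMod 2 → ℂ) :
    had (phaseVec x * had u) 0 =
        (1 + Complex.exp (-(x * Complex.I))) * u 0 + (1 - Complex.exp (-(x * Complex.I))) * u 1 ∧
      had (phaseVec x * had u) 1 =
        (1 - Complex.exp (-(x * Complex.I))) * u 0 + (1 + Complex.exp (-(x * Complex.I))) * u 1 := by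
  simp only [had_apply_zero, had_apply_one, Pi.mul_apply, phaseVec_apply_zero, phaseVec_apply_one]
  constructor <;> ring

/-- Every one-qubit vector is obtained from `|0⟩` by rotations about the `x` and `z` axes. -/
theorem exists_rotation_angles (u₀ u₁ : ℂ) : ∃ (η ξ : ℝ) (c : ℂ),
    u₀ = c * (1 + Complex.exp (-(ξ * Complex.I))) ∧
    u₁ = c * Complex.exp (-(η * Complex.I)) * (1 - Complex.exp (-(ξ * Complex.I))) := by
  obtain ⟨r, χ, h0, h1⟩ : ∃ r χ : ℝ, ‖u₀‖ = r * Real.cos χ ∧ ‖u₁‖ = r * Real.sin χ := by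
    refine ⟨‖(⟨‖u₀‖, ‖u₁‖⟩ : ℂ)‖, Complex.arg ⟨‖u₀‖, ‖u₁‖⟩, ?_, ?_⟩
    · rw [Complex.norm_mul_cos_arg]
    · rw [Complex.norm_mul_sin_arg]
  have e0 : u₀ = r * Complex.cos χ * Complex.exp (u₀.arg * Complex.I) := by
    conv_lhs => rw [← Complex.norm_mul_exp_arg_mul_I u₀, h0]
    push_cast; rfl
  have e1 : u₁ = r * Complex.sin χ * Complex.exp (u₁.arg * Complex.I) := by
    conv_lhs => rw [← Complex.norm_mul_exp_arg_mul_I u₁, h1]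
    push_cast; rfl
  set α := u₀.arg
  set β := u₁.arg
  have hinv : Complex.exp (χ * Complex.I) * Complex.exp (-(χ * Complex.I)) = 1 := by
    rw [← Complex.exp_add, add_neg_cancel, Complex.exp_zero]
  have hsq : Complex.exp (-(((2 * χ : ℝ) : ℂ) * Complex.I)) =
      Complex.exp (-(χ * Complex.I)) * Complex.exp (-(χ * Complex.I)) := by
    rw [← Complex.exp_add]; congr 1; push_cast; ring
  have hη : Complex.exp (-(((α - β + Real.pi / 2 : ℝ) : ℂ) * Complex.I)) *
      Complex.exp (α * Complex.I) = -Complex.I * Complex.exp (β * Complex.I) := by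
    have : -Complex.I = Complex.exp (-(Real.pi / 2 * Complex.I)) := by
      rw [Complex.exp_neg, Complex.exp_pi_div_two_mul_I, Complex.inv_I]
    rw [this, ← Complex.exp_add, ← Complex.exp_add]; congr 1; push_cast; ring
  have hcos : Complex.cos χ = (Complex.exp (χ * Complex.I) + Complex.exp (-(χ * Complex.I))) / 2 := by
    rw [Complex.cos, neg_mul]
  have hsin : Complex.sin χ =
      (Complex.exp (-(χ * Complex.I)) - Complex.exp (χ * Complex.I)) * Complex.I / 2 := by
    rw [Complex.sin, neg_mul]
  -- Here 1 + exp(-2iχ) = 2 exp(-iχ) cos χ and 1 - exp(-2iχ) = 2i exp(-iχ) sin χ; the shift π/2 in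
  -- `η` removes the extra factor i.
  refine ⟨α - β + Real.pi / 2, 2 * χ,
    r / 2 * Complex.exp (α * Complex.I) * Complex.exp (χ * Complex.I), ?_, ?_⟩
  · rw [e0, hsq, hcos]
    linear_combination (-(r : ℂ) / 2 * Complex.exp (α * Complex.I) *
      Complex.exp (-(χ * Complex.I))) * hinv
  · rw [e1, hsq, hsin]
    linear_combination (-(r : ℂ) / 2 * Complex.exp (χ * Complex.I) *
      (1 - Complex.exp (-(χ * Complex.I)) * Complex.exp (-(χ * Complex.I)))) * hη +
      (-(r : ℂ) / 2 * Complex.I * Complex.exp (β * Complex.I) *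
      Complex.exp (-(χ * Complex.I))) * hinv

/-- In the peeling step the value of the polynomial vector at -i may vanish, while a rotation needs
a direction; in dimension two a nonzero vector orthogonal to `x` always exists. -/
theorem exists_ne_zero_orthogonal (x₀ x₁ y₀ y₁ : ℂ)
    (h : x₀ * (starRingEnd ℂ) y₀ + x₁ * (starRingEnd ℂ) y₁ = 0) :
    ∃ u₀ u₁ l : ℂ, (u₀ ≠ 0 ∨ u₁ ≠ 0) ∧ y₀ = l * u₀ ∧ y₁ = l * u₁ ∧
      x₀ * (starRingEnd ℂ) u₀ + x₁ * (starRingEnd ℂ) u₁ = 0 := by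
  by_cases hy : y₀ ≠ 0 ∨ y₁ ≠ 0
  · exact ⟨y₀, y₁, 1, hy, by simp, by simp, h⟩
  · push Not at hy
    by_cases hx : x₀ ≠ 0 ∨ x₁ ≠ 0
    · refine ⟨-(starRingEnd ℂ) x₁, (starRingEnd ℂ) x₀, 0, ?_, by simp [hy.1], by simp [hy.2], ?_⟩
      · simpa [or_comm] using hx
      · simp; ring
    · push Not at hx
      exact ⟨1, 0, 0, by simp, by simp [hy.1], by simp [hy.2], by simp [hx.1]⟩

theorem eval_conj_map (p : ℂ[X]) (z : ℂ) :
    (p.map (starRingEnd ℂ)).eval ((starRingEnd ℂ) z) = (starRingEnd ℂ) (p.eval z) := by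
  rw [eval_map, eval₂_hom]

/-- Agreement on the infinitely many real points is an identity of polynomials, which can then be
evaluated off the real line, at i. -/
theorem conj_mul_eq_of_normSq_eq (h : ZMod 2 → ℂ[X]) (d : ℕ)
    (hh : ∀ t : ℝ, ∑ a, ‖(h a).eval (t : ℂ)‖ ^ 2 = (1 + t ^ 2) ^ d) :
    h 0 * (h 0).map (starRingEnd ℂ) + h 1 * (h 1).map (starRingEnd ℂ) = (1 + X ^ 2) ^ d := by
  refine eq_of_infinite_eval_eq _ _
    ((Set.infinite_range_of_injective Complex.ofReal_injective).mono ?_)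
  rintro _ ⟨t, rfl⟩
  have h1 : ∀ a, ((h a).map (starRingEnd ℂ)).eval (t : ℂ) =
      (starRingEnd ℂ) ((h a).eval (t : ℂ)) := fun a => by
    rw [← eval_conj_map, Complex.conj_ofReal]
  have h2 := congrArg (fun r : ℝ => (r : ℂ)) (hh t)
  simp only [sum_bit] at h2
  push_cast at h2
  simp only [Set.mem_ofPred_eq, eval_add, eval_mul, eval_pow, eval_one, eval_X, h1,
    Complex.mul_conj', h2]

theorem exists_factor_of_eval_eq_zero (p : ℂ[X]) (d : ℕ) (hd : p.natDegree ≤ d + 1) (z : ℂ)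
    (hz : z ≠ 0) (h : p.eval z = 0) :
    ∃ q : ℂ[X], q.natDegree ≤ d ∧ ∀ x, p.eval x = (1 - z⁻¹ * x) * q.eval x := by
  obtain ⟨r, hr⟩ := dvd_iff_isRoot.2 (show p.IsRoot z from h)
  refine ⟨C (-z) * r, (natDegree_C_mul_le _ _).trans ?_, fun x => ?_⟩
  · by_cases hr0 : r = 0
    · simp [hr0]
    · rw [hr, natDegree_mul (X_sub_C_ne_zero z) hr0, natDegree_X_sub_C] at hd
      omega
  · rw [hr]
    simp only [eval_mul, eval_sub, eval_X, eval_C]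
    field_simp
    ring

theorem exp_neg_mul_exp (x : ℝ) :
    Complex.exp (-(x * Complex.I)) * Complex.exp (x * Complex.I) = 1 := by
  rw [← Complex.exp_add, neg_add_cancel, Complex.exp_zero]

theorem conj_exp_mul_I (x : ℝ) : (starRingEnd ℂ) (Complex.exp (x * Complex.I)) =
    Complex.exp (-(x * Complex.I)) := by
  rw [← Complex.exp_conj, map_mul, Complex.conj_ofReal, Complex.conj_I, mul_neg]

theorem conj_exp_neg_mul_I (x : ℝ) : (starRingEnd ℂ) (Complex.exp (-(x * Complex.I))) =
    Complex.exp (x * Complex.I) := by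
  rw [← conj_exp_mul_I, Complex.conj_conj]

/-- Rotations about the `x` and `z` axes that split off one signal rotation from a polynomial
vector of norm `(1 + t²) ^ (d + 1)`. -/
theorem exists_strip (d : ℕ) (h : ZMod 2 → ℂ[X]) (hd : ∀ a, (h a).natDegree ≤ d + 1)
    (hh : ∀ t : ℝ, ∑ a, ‖(h a).eval (t : ℂ)‖ ^ 2 = (1 + t ^ 2) ^ (d + 1)) :
    ∃ (η ξ : ℝ) (h' : ZMod 2 → ℂ[X]), (∀ a, (h' a).natDegree ≤ d) ∧
      (∀ t : ℝ, ∑ a, ‖(h' a).eval (t : ℂ)‖ ^ 2 = (1 + t ^ 2) ^ d) ∧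
      ∀ x : ℂ, (1 + Complex.I * x) * (h' 0).eval x =
          (1 + Complex.exp (ξ * Complex.I)) / 2 * (h 0).eval x +
            (1 - Complex.exp (ξ * Complex.I)) / 2 * Complex.exp (η * Complex.I) * (h 1).eval x ∧
        (1 - Complex.I * x) * (h' 1).eval x =
          (1 - Complex.exp (ξ * Complex.I)) / 2 * (h 0).eval x +
            (1 + Complex.exp (ξ * Complex.I)) / 2 * Complex.exp (η * Complex.I) * (h 1).eval x := by
  -- The weight (1 + X²)^(d+1) vanishes at i, and conjugating coefficients turns evaluation at i
  -- into the conjugate of evaluation at -i.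
  have horth : (h 0).eval Complex.I * (starRingEnd ℂ) ((h 0).eval (-Complex.I)) +
      (h 1).eval Complex.I * (starRingEnd ℂ) ((h 1).eval (-Complex.I)) = 0 := by
    have h1 := congrArg (eval Complex.I) (conj_mul_eq_of_normSq_eq h (d + 1) hh)
    have h2 : ∀ a, ((h a).map (starRingEnd ℂ)).eval Complex.I =
        (starRingEnd ℂ) ((h a).eval (-Complex.I)) := fun a => by
      rw [← eval_conj_map, map_neg, Complex.conj_I, neg_neg]
    simpa [h2] using h1
  obtain ⟨u₀, u₁, l, hu, hy0, hy1, hx⟩ := exists_ne_zero_orthogonal _ _ _ _ horth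
  obtain ⟨η, ξ, c, hu0, hu1⟩ := exists_rotation_angles u₀ u₁
  have hc : c ≠ 0 := by
    rintro rfl
    simp [hu0, hu1] at hu
  have hc' : (starRingEnd ℂ) c ≠ 0 := by simpa using hc
  have hE := exp_neg_mul_exp ξ
  have hF := exp_neg_mul_exp η
  rw [hu0, hu1] at hx
  simp only [map_mul, map_add, map_sub, map_one, conj_exp_neg_mul_I] at hx
  rw [hu0] at hy0
  rw [hu1] at hy1
  have cE := conj_exp_mul_I ξ
  have cF := conj_exp_mul_I η
  set E := Complex.exp (-(ξ * Complex.I))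
  set Eb := Complex.exp (ξ * Complex.I)
  set F := Complex.exp (-(η * Complex.I))
  set Fb := Complex.exp (η * Complex.I)
  have hdeg : ∀ r s : ℂ, (C r * h 0 + C s * h 1).natDegree ≤ d + 1 := fun r s =>
    (natDegree_add_le _ _).trans (max_le ((natDegree_C_mul_le _ _).trans (hd 0))
      ((natDegree_C_mul_le _ _).trans (hd 1)))
  -- The rotation is the inverse of the one that prepares u from |0⟩. Its first row is proportional
  -- to the conjugate of u and so annihilates h(i).
  obtain ⟨p, hpd, hp⟩ := exists_factor_of_eval_eq_zero
    (C ((1 + Eb) / 2) * h 0 + C ((1 - Eb) / 2 * Fb) * h 1) d (hdeg _ _) Complex.I Complex.I_ne_zero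
    (by
      simp only [eval_add, eval_mul, eval_C]
      apply mul_left_cancel₀ hc'
      linear_combination hx / 2)
  -- The second row is orthogonal to u, hence annihilates h(-i) = l u.
  obtain ⟨q, hqd, hq⟩ := exists_factor_of_eval_eq_zero
    (C ((1 - Eb) / 2) * h 0 + C ((1 + Eb) / 2 * Fb) * h 1) d (hdeg _ _) (-Complex.I)
    (neg_ne_zero.2 Complex.I_ne_zero)
    (by
      simp only [eval_add, eval_mul, eval_C]
      rw [hy0, hy1]
      linear_combination (-l * c) * hE + (l * c * (1 + Eb) * (1 - E) / 2) * hF)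
  simp only [eval_add, eval_mul, eval_C, Complex.inv_I, inv_neg, neg_neg, neg_mul,
    sub_neg_eq_add] at hp hq
  refine ⟨η, ξ, fun a => if a = 0 then p else q, ?_, fun t => ?_, fun x => ⟨?_, ?_⟩⟩
  · rw [forall_bit]
    exact ⟨by simpa using hpd, by simpa using hqd⟩
  · have ht : (0 : ℝ) < 1 + t ^ 2 := by positivity
    apply mul_left_cancel₀ ht.ne'
    have hn1 : ‖1 + Complex.I * (t : ℂ)‖ ^ 2 = 1 + t ^ 2 := by
      rw [Complex.sq_norm, Complex.normSq_apply]; simp; ring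
    have hn2 : ‖1 - Complex.I * (t : ℂ)‖ ^ 2 = 1 + t ^ 2 := by
      rw [Complex.sq_norm, Complex.normSq_apply]; simp; ring
    -- The rotation is unitary, so the weight is kept and one factor 1 + t² can be cancelled.
    have hrot : ∀ x y : ℂ, ‖(1 + Eb) / 2 * x + (1 - Eb) / 2 * Fb * y‖ ^ 2 +
        ‖(1 - Eb) / 2 * x + (1 + Eb) / 2 * Fb * y‖ ^ 2 = ‖x‖ ^ 2 + ‖y‖ ^ 2 := by
      intro x y
      have : ((‖(1 + Eb) / 2 * x + (1 - Eb) / 2 * Fb * y‖ ^ 2 +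
        ‖(1 - Eb) / 2 * x + (1 + Eb) / 2 * Fb * y‖ ^ 2 : ℝ) : ℂ) = ((‖x‖ ^ 2 + ‖y‖ ^ 2 : ℝ) : ℂ) := by
        push_cast
        simp only [← Complex.mul_conj', map_add, map_sub, map_mul, map_div₀, map_one, cE, cF]
        simp only [Complex.conj_ofNat]
        generalize (starRingEnd ℂ) x = xb
        generalize (starRingEnd ℂ) y = yb
        linear_combination (x * xb / 2 - F * x * yb / 2 - Fb * y * xb / 2 + F * Fb * y * yb / 2) * hE
          + y * yb * hF
      exact_mod_cast this
    have h3 := hh t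
    simp only [sum_bit] at h3
    rw [← pow_succ', ← h3, ← hrot, hp, hq, norm_mul, norm_mul, mul_pow, mul_pow, hn1, hn2]
    simp [sum_bit]
    ring
  · simpa using (hp x).symm
  · simpa using (hq x).symm

/-- Induction on the degree by `exists_strip`: by `hφ`, diag(1 + it, 1 - it) is a scalar multiple of
the signal rotation. The pending z rotation `ζ` is absorbed into the next block, because it commutes
with the signal. -/
theorem realizable_of_eval {K : Type*} (τ t : K → ℝ) (φ : ℝ)
    (hφ : ∀ κ, ∃ c : ℂ, c ≠ 0 ∧ c = 1 + Complex.I * t κ ∧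
      c * Complex.exp (-((φ * τ κ : ℝ) * Complex.I)) = 1 - Complex.I * t κ) (d : ℕ) :
    ∀ h : ZMod 2 → ℂ[X], (∀ a, (h a).natDegree ≤ d) →
      (∀ t : ℝ, ∑ a, ‖(h a).eval (t : ℂ)‖ ^ 2 = (1 + t ^ 2) ^ d) →
      ∃ (ζ : ℝ) (v : K → ZMod 2 → ℂ), Realizable τ (d + 2) v ∧
        ∀ κ a, (h a).eval (t κ : ℂ) = phaseVec ζ a * v κ a := by
  induction d with
  | zero =>
    intro h hd hh
    have hC : ∀ a, h a = C ((h a).coeff 0) := fun a =>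
      eq_C_of_natDegree_eq_zero (Nat.le_zero.1 (hd a))
    obtain ⟨η, ξ, c, hu0, hu1⟩ := exists_rotation_angles ((h 0).coeff 0) ((h 1).coeff 0)
    have hF := exp_neg_mul_exp η
    have hc : c ≠ 0 := by
      rintro rfl
      have := hh 0
      rw [sum_bit, hC 0, hC 1, hu0, hu1] at this
      simp at this
    refine ⟨η, fun κ a => (h a).eval (t κ : ℂ) * (phaseVec η a)⁻¹, ?_, fun κ a => ?_⟩
    · have h0 : Realizable τ 0 fun _ => (1 : ZMod 2 → ℂ) :=
        ⟨0, 0, 0, fun κ => ⟨1, one_ne_zero, by rw [one_smul]; rfl⟩⟩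
      -- The chain starts in the vector (1, 1). The first block takes it to 2(1 + i)(1, 0), and the
      -- x rotation of the second block prepares the constant vector up to a z rotation.
      refine ((h0.step 0 (-(Real.pi / 2)) (-(Real.pi / 2))).step 0 0 ξ).congr fun κ =>
        ⟨2 * (1 + Complex.I) * c⁻¹, ?_, ?_⟩
      · refine mul_ne_zero (mul_ne_zero two_ne_zero fun h => ?_) (inv_ne_zero hc)
        simpa using congrArg Complex.re h
      have hI : Complex.exp (-(((-(Real.pi / 2) : ℝ) : ℂ) * Complex.I)) = Complex.I := by
        push_cast
        rw [neg_mul, neg_neg, Complex.exp_pi_div_two_mul_I]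
      have hII := Complex.I_mul_I
      funext a
      revert a
      simp only [zero_mul, phaseVec_zero, one_mul, mul_one]
      obtain ⟨k0, k1⟩ := had_phaseVec_had (-(Real.pi / 2)) (phaseVec (-(Real.pi / 2)))
      obtain ⟨l0, l1⟩ := had_phaseVec_had ξ (had (phaseVec (-(Real.pi / 2)) *
        had (phaseVec (-(Real.pi / 2)))))
      rw [forall_bit, l0, l1, k0, k1]
      simp only [phaseVec_apply_zero, phaseVec_apply_one, hI, Pi.smul_apply, smul_eq_mul]
      rw [hC 0, hC 1, eval_C, eval_C, hu0, hu1]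
      have hF0 : Complex.exp (-(η * Complex.I)) ≠ 0 := Complex.exp_ne_zero _
      constructor
      · field_simp
        linear_combination (-2 * Complex.exp (-(ξ * Complex.I))) * hII
      · field_simp
        linear_combination (2 * Complex.exp (-(ξ * Complex.I))) * hII
    · have : phaseVec η a ≠ 0 := by
        unfold phaseVec
        split_ifs
        · exact one_ne_zero
        · exact Complex.exp_ne_zero _
      field_simp
  | succ d ih =>
    intro h hd hh
    obtain ⟨η, ξ, h', hd', hh', hrec⟩ := exists_strip d h hd hh
    obtain ⟨ζ, v, hv, hev⟩ := ih h' hd' hh'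
    refine ⟨η, fun κ a => (h a).eval (t κ : ℂ) * (phaseVec (-η) a), ?_, fun κ a => ?_⟩
    · refine (hv.step φ ζ ξ).congr fun κ => ?_
      obtain ⟨c, hc, h1, h2⟩ := hφ κ
      refine ⟨2 * c⁻¹, mul_ne_zero two_ne_zero (inv_ne_zero hc), ?_⟩
      funext a
      revert a
      obtain ⟨r0, r1⟩ := hrec (t κ)
      rw [← h1, hev] at r0
      rw [← h2, hev] at r1
      obtain ⟨l0, l1⟩ := had_phaseVec_had ξ (phaseVec ζ * (phaseVec (φ * τ κ) * v κ))
      have hE := exp_neg_mul_exp ξ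
      rw [forall_bit, l0, l1]
      simp only [phaseVec_apply_zero, phaseVec_apply_one, Pi.smul_apply, smul_eq_mul,
        Pi.mul_apply] at r0 r1 ⊢
      have hη : Complex.exp (-(((-η : ℝ) : ℂ) * Complex.I)) = Complex.exp (η * Complex.I) := by
        push_cast; rw [neg_mul, neg_neg]
      rw [hη]
      clear h1 h2 l0 l1 hrec hη
      generalize Complex.exp (-(ξ * Complex.I)) = E at r0 r1 hE ⊢
      generalize Complex.exp (ξ * Complex.I) = Eb at r0 r1 hE ⊢
      generalize Complex.exp (η * Complex.I) = Fb at r0 r1 ⊢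
      generalize Complex.exp (-(ζ * Complex.I)) = Z at r0 r1 ⊢
      generalize Complex.exp (-((φ * τ κ : ℝ) * Complex.I)) = S at r0 r1 ⊢
      constructor
      · apply mul_left_cancel₀ hc
        field_simp
        linear_combination (1 + E) * r0 + (1 - E) * r1 +
          ((h 0).eval (t κ : ℂ) - Fb * (h 1).eval (t κ : ℂ)) * hE
      · apply mul_left_cancel₀ hc
        field_simp
        linear_combination (1 - E) * r0 + (1 + E) * r1 +
          (-(h 0).eval (t κ : ℂ) + Fb * (h 1).eval (t κ : ℂ)) * hE
    · have : phaseVec η a * phaseVec (-η) a = 1 := by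
        rw [← Pi.mul_apply, ← phaseVec_add, add_neg_cancel, phaseVec_zero, Pi.one_apply]
      linear_combination (-(h a).eval (t κ : ℂ)) * this

/-- Angles for which the state after `4 n` blocks and one more rotation about the `z` axis
distinguishes the values of `g`. -/
theorem exists_angles (n : ℕ) (hn : 0 < n) (g : ℕ → ZMod 2) : ∃ φ ζ ξ : ℕ → ℝ, ∀ k : ℕ, k ≤ n →
    had (phaseVec (ζ (4 * n)) * (phaseVec (φ (4 * n) * (n - 2 * k)) *
      blockState φ ζ ξ (n - 2 * k) (4 * n))) (g k + 1) = 0 := by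
  obtain ⟨h, hd, hh, hg⟩ := exists_interpolating_pair n g
  let s : ℂ := ((Real.sqrt 2)⁻¹ : ℝ)
  have hs : ‖s‖ ^ 2 = 1 / 2 := by
    simp [s, inv_pow]
  -- The last measurement applies one more Hadamard, so its preimage is synthesised; the factor 1/√2
  -- keeps the weight (1 + t²)^n.
  let w : ZMod 2 → ℂ[X] := fun a => C s * (h 0 + C (sgn a) * h 1)
  obtain ⟨ζ₀, v, hv, hev⟩ := realizable_of_eval (K := {k : ℕ // k ≤ n})
    (fun k => (n - 2 * (k : ℕ) : ℝ)) (fun k => realNode n (k : ℕ)) (Real.pi / (n + 1))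
    (fun k => by
      obtain ⟨h1, h2⟩ := one_add_realNode n k k.2
      refine ⟨_, ?_, rfl, ?_⟩
      · rw [h1]; exact mul_ne_zero (node_ne_zero _ _) h2
      · rw [h1, mul_right_comm, node, ← Complex.exp_add]
        convert one_mul _
        rw [Complex.exp_eq_one_iff]
        refine ⟨0, ?_⟩
        push_cast
        ring) n w
    (fun a => (natDegree_C_mul_le _ _).trans ((natDegree_add_le _ _).trans
      (max_le (hd 0) ((natDegree_C_mul_le _ _).trans (hd 1)))))
    (fun t => by
      have h1 := parallelogram_law_with_norm ℝ ((h 0).eval (t : ℂ)) ((h 1).eval (t : ℂ))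
      have h2 := hh t
      rw [sum_bit] at h2 ⊢
      simp only [w, eval_mul, eval_C, eval_add, norm_mul, mul_pow, hs, sgn_zero, sgn_one, one_mul,
        neg_mul, ← sub_eq_add_neg]
      rw [← h2]
      linear_combination h1 / 2)
  -- Index 4n belongs to a final truncated block: its signal is switched off, and its z rotation is
  -- the pending one.
  obtain ⟨φ, ζ, ξ, hst⟩ := hv.pad (show n + 2 ≤ 4 * n by omega)
  refine ⟨Function.update φ (4 * n) 0, Function.update ζ (4 * n) ζ₀, ξ, fun k hk => ?_⟩
  have hcongr : blockState (Function.update φ (4 * n) 0) (Function.update ζ (4 * n) ζ₀) ξ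
      (n - 2 * k) (4 * n) = blockState φ ζ ξ (n - 2 * k) (4 * n) :=
    blockState_congr _ _ fun i hi => by simp [Function.update_of_ne hi.ne]
  obtain ⟨c, -, hc⟩ := hst ⟨k, hk⟩
  have hw : phaseVec ζ₀ * v ⟨k, hk⟩ = fun a => (w a).eval (realNode n k : ℂ) := by
    funext a
    exact (hev ⟨k, hk⟩ a).symm
  simp only at hc
  rw [hcongr, hc]
  simp only [Function.update_self, zero_mul, phaseVec_zero, one_mul, mul_smul_comm, had_smul, hw]
  have hhad : ∀ b, had (fun a => (w a).eval (realNode n k : ℂ)) b =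
      2 * s * (h b).eval (realNode n k : ℂ) := by
    rw [forall_bit, had_apply_zero, had_apply_one]
    simp only [w, eval_mul, eval_C, eval_add, sgn_zero, sgn_one]
    constructor <;> ring
  rw [Pi.smul_apply, hhad, hg k hk]
  simp

end SignalProcessing

/-! ### Tensor products and the preparation of the cluster state -/

theorem tensorOp_mul {N : ℕ} (M M' : Fin N → QubitOp) :
    tensorOp M * tensorOp M' = tensorOp fun k => M k * M' k := by
  ext a c
  simp only [tensorOp, Matrix.mul_apply, Matrix.of_apply, ← Finset.prod_mul_distrib]
  rw [Finset.prod_univ_sum, Fintype.piFinset_univ]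

theorem tensorOp_one (N : ℕ) : tensorOp (fun _ : Fin N => (1 : QubitOp)) = 1 := by
  ext a c
  simp only [tensorOp, Matrix.of_apply, Matrix.one_apply]
  by_cases h : a = c
  · simp [h]
  · obtain ⟨k, hk⟩ := Function.ne_iff.1 h
    rw [if_neg h]
    exact Finset.prod_eq_zero (Finset.mem_univ k) (if_neg hk)

theorem prod_hadamardOn {N : ℕ} (l : List (Fin N)) (hl : l.Nodup) :
    (l.map hadamardOn).prod = tensorOp fun k => if k ∈ l then hadamard else 1 := by
  induction l with
  | nil => simp [tensorOp_one]
  | cons j l ih =>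
    rw [List.nodup_cons] at hl
    rw [List.map_cons, List.prod_cons, ih hl.2, hadamardOn, tensorOp_mul]
    congr 1
    funext k
    by_cases hk : k = j
    · subst hk; simp [hl.1]
    · simp [hk]

theorem prod_map_diagonal {ι α : Type*} [Fintype α] [DecidableEq α] (d : ι → α → ℂ) (l : List ι) :
    (l.map fun j => Matrix.diagonal (d j)).prod =
      Matrix.diagonal fun a => (l.map fun j => d j a).prod := by
  induction l with
  | nil => simp
  | cons j l ih => simp [ih]

theorem tensorOp_hadamard_mulVec_zeroState (N : ℕ) :
    (tensorOp fun _ : Fin N => hadamard) *ᵥ zeroState N = fun _ => ((Real.sqrt 2 : ℂ)⁻¹) ^ N := by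
  funext a
  simp [zeroState, tensorOp, hadamard]

theorem clusterState_apply (N : ℕ) (a : Fin (N + 1) → ZMod 2) : clusterState (N + 1) a =
    (∏ j : Fin N, sgn (a j.castSucc * a j.succ)) * ((Real.sqrt 2 : ℂ)⁻¹) ^ (N + 1) := by
  rw [clusterState, ← Matrix.mulVec_mulVec, tensorOp_hadamard_mulVec_zeroState]
  have := prod_map_diagonal (fun (j : Fin N) (a : Fin (N + 1) → ZMod 2) =>
    sgn (a j.castSucc * a j.succ)) (List.finRange N)
  erw [this]
  rw [Matrix.mulVec_diagonal, Fin.prod_univ_def]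

theorem norm_sgn (b : ZMod 2) : ‖sgn b‖ = 1 := by
  simp [sgn]

theorem norm_inv_sqrt_two_pow_sq (N : ℕ) :
    ‖((Real.sqrt 2 : ℂ)⁻¹) ^ N‖ ^ 2 = (1 / 2 : ℝ) ^ N := by
  rw [norm_pow, ← pow_mul, mul_comm, pow_mul]
  simp

theorem sum_normSq_clusterState (N : ℕ) :
    ∑ a, ‖clusterState (N + 1) a‖ ^ 2 = 1 := by
  simp only [clusterState_apply, norm_mul, norm_prod, norm_sgn, Finset.prod_const_one, one_mul,
    norm_inv_sqrt_two_pow_sq]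
  simp [ZMod.card]

/-- The cluster state is prepared by a layer of Hadamard gates and two layers of `CZ` gates. -/
theorem preparedInDepth_clusterState (N : ℕ) (hN : 2 ≤ N) :
    PreparedInDepth (clusterState (N + 1)) 3 := by
  have hcz : ∀ e : ℕ, (((List.finRange N).filter fun j : Fin N => j.val % 2 = e).map
      fun j => Gate.cz j.castSucc j.succ rfl).Pairwise
        fun g h => Disjoint g.support h.support := by
    intro e
    rw [List.pairwise_map]
    refine List.Nodup.pairwise_of_forall_ne ((List.nodup_finRange N).filter _) ?_
    intro a ha b hb hab
    simp only [List.mem_filter, List.mem_finRange, true_and, decide_eq_true_eq] at ha hb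
    have : a.val ≠ b.val := fun h => hab (Fin.ext h)
    simp only [Gate.support, Finset.disjoint_left, Finset.mem_insert, Finset.mem_singleton,
      Fin.ext_iff, Fin.val_castSucc, Fin.val_succ]
    omega
  -- Gates of equal parity have disjoint supports; `2 ≤ N` provides at least one gate of each
  -- parity.
  have hne : ∀ e < 2, (((List.finRange N).filter fun j : Fin N => j.val % 2 = e).map
      fun j => Gate.cz j.castSucc j.succ rfl) ≠ [] := by
    intro e he h
    rw [List.map_eq_nil_iff, List.filter_eq_nil_iff] at h
    have := h ⟨e, by omega⟩ (List.mem_finRange _)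
    simp at this
    omega
  let L1 : Layer (N + 1) := ⟨(List.finRange (N + 1)).map Gate.had, by simp, by
    rw [List.pairwise_map]
    refine (List.nodup_finRange (N + 1)).imp fun h => ?_
    simpa [Gate.support] using h⟩
  let L2 (e : ℕ) (he : e < 2) : Layer (N + 1) := ⟨_, hne e he, hcz e⟩
  have h1 : L1.op = tensorOp fun _ => hadamard := by
    have := prod_hadamardOn (List.finRange (N + 1)) (List.nodup_finRange _)
    simp only [List.mem_finRange, if_true] at this
    rw [← this, Layer.op, List.map_map]
    rfl
  have h2 : ∀ e he, (L2 e he).op = Matrix.diagonal fun a : Fin (N + 1) → ZMod 2 =>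
      ∏ j : Fin N with j.val % 2 = e, sgn (a j.castSucc * a j.succ) := by
    intro e he
    have := prod_map_diagonal (fun (j : Fin N) (a : Fin (N + 1) → ZMod 2) =>
      sgn (a j.castSucc * a j.succ)) ((List.finRange N).filter fun j : Fin N => j.val % 2 = e)
    rw [Layer.op, List.map_map]
    refine this.trans ?_
    congr 1
  refine ⟨[L1, L2 0 (by norm_num), L2 1 (by norm_num)], rfl, ?_⟩
  simp only [runCircuit, List.foldl_cons, List.foldl_nil, h1, h2]
  rw [tensorOp_hadamard_mulVec_zeroState]
  funext a
  rw [Matrix.mulVec_diagonal, Matrix.mulVec_diagonal, clusterState_apply, ← mul_assoc]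
  congr 1
  rw [← Finset.prod_filter_mul_prod_filter_not Finset.univ (fun j : Fin N => j.val % 2 = 1)]
  congr 1
  refine Finset.prod_congr (Finset.filter_congr fun j _ => ?_) fun _ _ => rfl
  omega

/-! ### Measuring a chain qubit by qubit -/

/-- The (unnormalized) state of qubit `k` of the chain after the qubits before it have been
projected with the functionals `c`. -/
def transfer (c : ℕ → ZMod 2 → ℂ) : ℕ → ZMod 2 → ℂ
  | 0 => 1
  | k + 1 => had (c k * transfer c k)

/-- A transfer-matrix computation. Keeping `F` arbitrary lets the induction absorb the sum over the
last qubit into the functional on its neighbour. -/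
theorem sum_chain (c : ℕ → ZMod 2 → ℂ) (N : ℕ) : ∀ F : ZMod 2 → ℂ,
    ∑ a : Fin (N + 1) → ZMod 2,
      (∏ k : Fin N, c k (a k.castSucc) * sgn (a k.castSucc * a k.succ)) * F (a (Fin.last N)) =
    ∑ b, transfer c N b * F b := by
  induction N with
  | zero =>
    intro F
    rw [← (Equiv.funUnique (Fin 1) (ZMod 2)).symm.sum_comp]
    simp [transfer]
  | succ N ih =>
    intro F
    rw [← (Fin.snocEquiv fun _ : Fin (N + 2) => ZMod 2).sum_comp, Fintype.sum_prod_type,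
      Finset.sum_comm]
    have h1 := ih fun b => c N b * ∑ y, sgn (b * y) * F y
    refine Eq.trans (Finset.sum_congr rfl fun a _ => ?_) (h1.trans ?_)
    · rw [Finset.mul_sum, Finset.mul_sum]
      refine Finset.sum_congr rfl fun y _ => ?_
      rw [Fin.prod_univ_castSucc]
      simp only [Fin.snocEquiv_apply, Fin.snoc_castSucc, Fin.succ_castSucc, Fin.succ_last,
        Fin.snoc_last, Fin.val_castSucc, Fin.val_last]
      ring
    · simp only [transfer, had, Pi.mul_apply, Finset.mul_sum, Finset.sum_mul]
      rw [Finset.sum_comm]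
      exact Finset.sum_congr rfl fun y _ => Finset.sum_congr rfl fun b _ => by ring

/-- The last qubit has no successor; its plain sum is the component 0 of one further Hadamard. -/
theorem sum_prod_mul_clusterState (c : ℕ → ZMod 2 → ℂ) (N : ℕ) :
    ∑ a, (∏ k : Fin (N + 1), c k (a k)) * clusterState (N + 1) a =
      transfer c (N + 1) 0 * ((Real.sqrt 2 : ℂ)⁻¹) ^ (N + 1) := by
  have h1 : transfer c (N + 1) 0 = ∑ b, transfer c N b * c N b := by
    simp only [transfer, had, mul_zero, sgn_zero, one_mul, Pi.mul_apply]
    exact Finset.sum_congr rfl fun b _ => mul_comm _ _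
  rw [h1, ← sum_chain, Finset.sum_mul]
  refine Finset.sum_congr rfl fun a _ => ?_
  rw [clusterState_apply, Fin.prod_univ_castSucc, Finset.prod_mul_distrib]
  simp only [Fin.val_castSucc, Fin.val_last]
  ring

/-- The sign `(-1)^b` of a bit as a real number. -/
def rsgn (b : ZMod 2) : ℝ := if b = 0 then 1 else -1

@[simp] theorem rsgn_zero : rsgn 0 = 1 := by simp [rsgn]

@[simp] theorem rsgn_one : rsgn 1 = -1 := by simp [rsgn]

theorem rsgn_add (a b : ZMod 2) : rsgn (a + b) = rsgn a * rsgn b := by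
  revert a b
  simp only [forall_bit]
  have : (1 + 1 : ZMod 2) = 0 := rfl
  simp [this]

/-- Byproduct operators `X^A Z^B` commute through a measurement, up to phases, if the sign of the
angle is adapted to `A`. -/
theorem had_byproduct (A B m : ZMod 2) (α : ℝ) (v : ZMod 2 → ℂ) : ∃ u : ℂ, ‖u‖ = 1 ∧ ∀ b,
    had (fun a => sgn (m * a) * phaseVec (rsgn A * α) a * (sgn (B * (a + A)) * v (a + A))) b =
      u * sgn (A * (b + (m + B))) * had (phaseVec α * v) (b + (m + B)) := by
  have h2 : (1 + 1 : ZMod 2) = 0 := rfl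
  have hE := exp_neg_mul_exp α
  refine ⟨(if A = 0 then 1 else sgn m * Complex.exp (α * Complex.I)) * sgn (A * (m + B)), ?_, ?_⟩
  · split_ifs <;> simp [norm_sgn, Complex.norm_exp_ofReal_mul_I]
  · revert A B m
    simp only [forall_bit, zero_add, add_zero, h2, had_apply_zero, had_apply_one, mul_zero, zero_mul,
      mul_one, one_mul, sgn_zero, sgn_one, rsgn_zero, rsgn_one, phaseVec_apply_zero,
      phaseVec_apply_one, Pi.mul_apply, if_true, one_ne_zero, if_false, Complex.ofReal_neg,
      neg_mul, neg_neg]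
    generalize Complex.exp (α * Complex.I) = e at *
    generalize Complex.exp (-(α * Complex.I)) = e' at *
    refine ⟨⟨⟨⟨?_, ?_⟩, ?_, ?_⟩, ⟨?_, ?_⟩, ?_, ?_⟩, ⟨⟨?_, ?_⟩, ?_, ?_⟩, ⟨?_, ?_⟩, ?_, ?_⟩ <;>
      first
      | trivial
      | ring1
      | linear_combination (v 1) * hE
      | linear_combination (-v 1) * hE

/-- The exponent of the byproduct operator `X` before the measurement of qubit `k`. -/
def xParity (m : ℕ → ZMod 2) (k : ℕ) : ZMod 2 := ∑ j ∈ Finset.range k with Odd (j + k), m j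

/-- The exponent of the byproduct operator `Z` before the measurement of qubit `k`. -/
def zParity (m : ℕ → ZMod 2) (k : ℕ) : ZMod 2 := ∑ j ∈ Finset.range k with Even (j + k), m j

theorem xParity_succ (m : ℕ → ZMod 2) (k : ℕ) : xParity m (k + 1) = m k + zParity m k := by
  rw [xParity, zParity, Finset.sum_filter, Finset.sum_filter, Finset.sum_range_succ, add_comm]
  congr 1
  · rw [if_pos ⟨k, by ring⟩]
  · refine Finset.sum_congr rfl fun j _ => if_congr ?_ rfl rfl
    rw [← add_assoc, Nat.odd_add_one, Nat.not_odd_iff_even]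

theorem zParity_succ (m : ℕ → ZMod 2) (k : ℕ) : zParity m (k + 1) = xParity m k := by
  rw [xParity, zParity, Finset.sum_filter, Finset.sum_filter, Finset.sum_range_succ, if_neg,
    add_zero]
  · refine Finset.sum_congr rfl fun j _ => if_congr ?_ rfl rfl
    rw [← add_assoc, Nat.even_add_one, Nat.not_even_iff_odd]
  · rw [← add_assoc, Nat.even_add_one, not_not]
    exact ⟨k, rfl⟩

/-- The Hadamard exchanges X and Z, and outcome m adds a Z before it, so the exponents evolve by (A,
B) ↦ (m + B, A). The two parities solve this recursion. -/
theorem transfer_byproduct (m : ℕ → ZMod 2) (α β : ℕ → ℝ) (N : ℕ)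
    (h : ∀ k < N, β k = rsgn (xParity m k) * α k) : ∀ k ≤ N, ∃ u : ℂ, ‖u‖ = 1 ∧ ∀ b,
    transfer (fun k a => sgn (m k * a) * phaseVec (β k) a) k b =
      u * sgn (zParity m k * (b + xParity m k)) *
        transfer (fun k => phaseVec (α k)) k (b + xParity m k) := by
  intro k
  induction k with
  | zero => exact fun _ => ⟨1, by simp, fun b => by simp [transfer, xParity, zParity]⟩
  | succ k ih =>
    intro hk
    obtain ⟨u, hu, h1⟩ := ih (by omega)
    obtain ⟨u', hu', h2⟩ := had_byproduct (xParity m k) (zParity m k) (m k) (α k)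
      (transfer (fun k => phaseVec (α k)) k)
    refine ⟨u * u', by rw [norm_mul, hu, hu', one_mul], fun b => ?_⟩
    rw [transfer, transfer, xParity_succ, zParity_succ, mul_assoc u u', mul_assoc u (u' * _),
      ← h2, ← smul_eq_mul u, ← Pi.smul_apply, ← had_smul]
    congr 1
    funext a
    rw [Pi.mul_apply, h1, h k (by omega), Pi.smul_apply, smul_eq_mul]
    ring

theorem norm_phaseVec (θ : ℝ) (a : ZMod 2) : ‖phaseVec θ a‖ = 1 := by
  unfold phaseVec
  split_ifs
  · simp
  · rw [← neg_mul, ← Complex.ofReal_neg, Complex.norm_exp_ofReal_mul_I]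

/-- Phases preserve the norm, and each unnormalized Hadamard doubles its square. -/
theorem sum_normSq_transfer (α : ℕ → ℝ) (N : ℕ) :
    ∑ b, ‖transfer (fun k => phaseVec (α k)) N b‖ ^ 2 = 2 ^ (N + 1) := by
  induction N with
  | zero => simp [transfer]
  | succ N ih =>
    rw [sum_bit] at ih ⊢
    rw [transfer, had_apply_zero, had_apply_one]
    have h1 := parallelogram_law_with_norm ℝ
      ((phaseVec (α N) * transfer (fun k => phaseVec (α k)) N) 0)
      ((phaseVec (α N) * transfer (fun k => phaseVec (α k)) N) 1)
    simp only [Pi.mul_apply, norm_mul, norm_phaseVec, one_mul] at h1 ⊢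
    linear_combination h1 + 2 * ih

/-! ### `l2`-MBQC on the cluster state with measurements in the equatorial plane -/

/-- The observable `cos β X + sin β Y`. -/
def xyObs (β : ℝ) : QubitOp :=
  Matrix.of fun a b => if a = b then 0 else
    if a = 0 then Complex.exp (-(β * Complex.I)) else Complex.exp (β * Complex.I)

theorem xyObs_isHermitian (β : ℝ) : (xyObs β).IsHermitian := by
  ext a b
  revert a b
  simp [forall_bit, xyObs, ← Complex.exp_conj, Complex.conj_ofReal]

theorem xyObs_sq (β : ℝ) : xyObs β * xyObs β = 1 := by
  have h := exp_neg_mul_exp β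
  have h' : Complex.exp (β * Complex.I) * Complex.exp (-(β * Complex.I)) = 1 := by
    rw [mul_comm, h]
  ext a b
  revert a b
  simp [forall_bit, xyObs, Matrix.mul_apply, sum_bit, h, h']

theorem xyObs_trace (β : ℝ) : (xyObs β).trace = 0 := by
  simp [Matrix.trace, xyObs]

theorem proj_xyObs (β : ℝ) (m a b : ZMod 2) :
    ((1 / 2 : ℂ) • (1 + sgn m • xyObs β)) a b = 1 / 2 *
      ((starRingEnd ℂ) (sgn (m * a) * phaseVec β a) * (sgn (m * b) * phaseVec β b)) := by
  have h := exp_neg_mul_exp β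
  revert m a b
  simp [forall_bit, xyObs, ← Complex.exp_conj, Complex.conj_ofReal, mul_comm, ← Complex.exp_add]

/-- The `l2`-MBQC on the cluster state that measures qubit `k` at the angle `± θ k`; the sign is
adapted to the byproduct operators if `k` is active. -/
def chainMBQC {n : ℕ} (N : ℕ) (θ : ℕ → ℝ) (P : Matrix (Fin (N + 1)) (Fin n) (ZMod 2))
    (active : ℕ → Prop) [DecidablePred active] : L2MBQC n (N + 1) where
  state := clusterState (N + 1)
  state_norm := sum_normSq_clusterState N
  obs k s := xyObs (rsgn s * θ k)
  obs_isHermitian _ _ := xyObs_isHermitian _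
  obs_sq _ _ := xyObs_sq _
  obs_trace _ _ := xyObs_trace _
  pre := P
  adapt := Matrix.of fun k j => if active k ∧ j < k ∧ Odd (j.val + k.val) then 1 else 0
  adapt_lower := ⟨1, fun k j h => by
    by_contra hjk
    exact h (if_neg fun h' => hjk h'.2.1)⟩
  outMask k := if Odd (k.val + (N + 1)) then 1 else 0
  outConst := 0

section chain

variable {n N : ℕ} {θ : ℕ → ℝ} {P : Matrix (Fin (N + 1)) (Fin n) (ZMod 2)}
  {active : ℕ → Prop} [DecidablePred active]

/-- Extension of a bit string by zeros. -/
def extend (m : Fin N → ZMod 2) (k : ℕ) : ZMod 2 := if h : k < N then m ⟨k, h⟩ else 0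

@[simp] theorem extend_val (m : Fin N → ZMod 2) (k : Fin N) : extend m k = m k := by
  simp [extend]

theorem sum_eq_xParity (m : Fin N → ZMod 2) (k : ℕ) (hk : k ≤ N) :
    ∑ j : Fin N, (if j.val < k ∧ Odd (j.val + k) then 1 else 0) * m j =
      xParity (extend m) k := by
  have h1 := Fin.sum_univ_eq_sum_range (fun j => (if j < k ∧ Odd (j + k) then 1 else 0) *
    extend m j) N
  simp only [extend_val] at h1
  rw [h1, xParity]
  simp only [ite_mul, one_mul, zero_mul]
  rw [← Finset.sum_filter]
  refine Finset.sum_congr ?_ fun _ _ => rfl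
  ext j
  simp only [Finset.mem_filter, Finset.mem_range]
  constructor
  · exact fun h => h.2
  · exact fun h => ⟨lt_of_lt_of_le h.1 hk, h⟩

theorem output_chainMBQC (m : Fin (N + 1) → ZMod 2) :
    (chainMBQC N θ P active).output m = xParity (extend m) (N + 1) := by
  rw [← sum_eq_xParity m (N + 1) le_rfl]
  simp only [L2MBQC.output, chainMBQC, dotProduct, add_zero]
  refine Finset.sum_congr rfl fun j _ => ?_
  simp [j.isLt]

theorem setting_chainMBQC (x : Fin n → ZMod 2) (m : Fin (N + 1) → ZMod 2) (k : Fin (N + 1)) :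
    (chainMBQC N θ P active).setting x m k =
      (P *ᵥ x) k + if active k then xParity (extend m) k else 0 := by
  rw [← sum_eq_xParity m k k.isLt.le]
  simp only [L2MBQC.setting, chainMBQC, Pi.add_apply]
  congr 1
  simp only [Matrix.mulVec, dotProduct, Matrix.of_apply]
  split_ifs with h
  · simp [h]
  · simp [h]

/-- The angles at which the chain would be measured on input `x` without byproducts. -/
def idealAngle (θ : ℕ → ℝ) (P : Matrix (Fin N) (Fin n) (ZMod 2)) (x : Fin n → ZMod 2)
    (k : ℕ) : ℝ := rsgn (extend (P *ᵥ x) k) * θ k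

/-- The projections have rank one, so a single amplitude decides; moving the byproducts to the end
leaves the ideal amplitude at the output bit. Inactive qubits need no adaptation, since the angle 0
has no sign. -/
theorem outcomeProb_chainMBQC (hθ : ∀ k, ¬ active k → θ k = 0) (x : Fin n → ZMod 2)
    (m : Fin (N + 1) → ZMod 2) :
    (chainMBQC N θ P active).outcomeProb x m =
      ‖transfer (fun k => phaseVec (idealAngle θ P x k)) (N + 1)
        ((chainMBQC N θ P active).output m)‖ ^ 2 * (1 / 4) ^ (N + 1) := by
  set M := chainMBQC N θ P active
  let β : ℕ → ℝ := fun k => rsgn (extend (M.setting x m) k) * θ k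
  let c : ℕ → ZMod 2 → ℂ := fun k a => sgn (extend m k * a) * phaseVec (β k) a
  have hc : ∀ k a, ‖c k a‖ = 1 := fun k a => by
    simp only [c, norm_mul, norm_sgn, norm_phaseVec, one_mul]
  obtain ⟨u, hu, htr⟩ := transfer_byproduct (extend m) (idealAngle θ P x) β (N + 1)
    (fun k hk => by
      simp only [β, idealAngle, ← mul_assoc, ← rsgn_add]
      by_cases ha : active k
      · congr 2
        simp only [extend, hk, dif_pos]
        rw [setting_chainMBQC, if_pos ha, add_comm]
      · rw [hθ k ha]; simp) (N + 1) le_rfl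
  have hproj : ∀ (k : Fin (N + 1)) a b, M.proj k (M.setting x m k) (m k) a b =
      1 / 2 * ((starRingEnd ℂ) (c k a) * c k b) := fun k a b => by
    refine (proj_xyObs _ _ _ _).trans ?_
    simp only [c, β, extend_val]
  have hvec : ∀ a, (tensorOp (fun k => M.proj k (M.setting x m k) (m k)) *ᵥ M.state) a =
      (1 / 2) ^ (N + 1) * (∏ k : Fin (N + 1), (starRingEnd ℂ) (c k (a k))) *
        (transfer c (N + 1) 0 * ((Real.sqrt 2 : ℂ)⁻¹) ^ (N + 1)) := by
    intro a
    rw [← sum_prod_mul_clusterState, Finset.mul_sum]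
    refine Finset.sum_congr rfl fun b _ => ?_
    simp only [tensorOp, Matrix.of_apply, hproj, Finset.prod_mul_distrib, Finset.prod_const,
      Finset.card_univ, Fintype.card_fin, mul_assoc]
    rfl
  have hT : ‖transfer c (N + 1) 0‖ = ‖transfer (fun k => phaseVec (idealAngle θ P x k)) (N + 1)
        (M.output m)‖ := by
    rw [htr 0, output_chainMBQC, norm_mul, norm_mul, hu, norm_sgn, zero_add, one_mul, one_mul]
  simp only [L2MBQC.outcomeProb, hvec, norm_mul, norm_prod, RCLike.norm_conj, hc,
    Finset.prod_const_one, mul_pow, norm_inv_sqrt_two_pow_sq, hT, Finset.sum_const,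
    Finset.card_univ, Fintype.card_fun, ZMod.card, Fintype.card_fin, nsmul_eq_mul]
  -- The factors come from the number of basis vectors, the projections and the normalization of the
  -- cluster state.
  have h4 : (1 / 4 : ℝ) ^ (N + 1) = 2 ^ (N + 1) * ((1 / 2) ^ (N + 1)) ^ 2 * (1 / 2) ^ (N + 1) := by
    rw [← pow_mul, mul_comm (N + 1) 2, pow_mul, ← mul_pow, ← mul_pow]
    norm_num
  rw [h4]
  simp only [norm_pow, norm_div, norm_one, Complex.norm_ofNat]
  push_cast
  ring

/-- The last outcome always enters the output, so flipping it matches the two classes. -/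
theorem card_output_eq (y : ZMod 2) :
    (Finset.univ.filter fun m => (chainMBQC N θ P active).output m = y).card = 2 ^ N := by
  set M := chainMBQC N θ P active
  have h11 : ∀ z : ZMod 2, z + 1 + 1 = z := by decide
  let flip : (Fin (N + 1) → ZMod 2) → Fin (N + 1) → ZMod 2 := fun m => m + Pi.single (Fin.last N) 1
  have hflip : ∀ m, M.output (flip m) = M.output m + 1 := by
    intro m
    have : M.outMask (Fin.last N) = 1 := if_pos ⟨N, by simp; ring⟩
    simp only [L2MBQC.output, flip, dotProduct_add, dotProduct_single, this]
    ring
  have hff : ∀ m, flip (flip m) = m := fun m => by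
    funext k
    simp only [flip, Pi.add_apply]
    by_cases hk : k = Fin.last N
    · subst hk; simp [h11]
    · simp [hk]
  have h1 : (Finset.univ.filter fun m => M.output m = y).card =
      (Finset.univ.filter fun m => ¬ M.output m = y).card := by
    refine Finset.card_nbij' flip flip ?_ ?_ (fun m _ => hff m) fun m _ => hff m
    · intro m hm
      simp only [Finset.coe_filter, Finset.mem_univ, true_and, Set.mem_ofPred_eq, hflip] at hm ⊢
      rw [hm]; clear hm; revert y; decide
    · intro m hm
      simp only [Finset.coe_filter, Finset.mem_univ, true_and, Set.mem_ofPred_eq, hflip] at hm ⊢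
      generalize M.output m = z at hm
      revert y z; decide
  have h2 := Finset.card_filter_add_card_filter_not (s := (Finset.univ : Finset (Fin (N + 1) → ZMod 2)))
    (fun m => M.output m = y)
  rw [← h1, Finset.card_univ, Fintype.card_fun, ZMod.card, Fintype.card_fin, pow_succ] at h2
  omega

/-- If the wrong amplitude vanishes, the right one carries the whole squared norm 2^(N+2); its 2^N
outcome strings, each weighted by 4^(-(N+1)), then have total probability 1. -/
theorem computes_chainMBQC (hθ : ∀ k, ¬ active k → θ k = 0) (f : (Fin n → ZMod 2) → ZMod 2)
    (hf : ∀ x, transfer (fun k => phaseVec (idealAngle θ P x k)) (N + 1) (f x + 1) = 0) :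
    (chainMBQC N θ P active).Computes f := by
  intro x
  have h1 := sum_normSq_transfer (idealAngle θ P x) (N + 1)
  have h2 : ‖transfer (fun k => phaseVec (idealAngle θ P x k)) (N + 1) (f x)‖ ^ 2 =
      2 ^ (N + 1 + 1) := by
    rw [← h1]
    have hx := hf x
    generalize f x = y at hx
    revert y
    rw [forall_bit, sum_bit]
    have : (1 + 1 : ZMod 2) = 0 := rfl
    rw [zero_add, this]
    exact ⟨fun h => by simp [h], fun h => by simp [h]⟩
  rw [Finset.sum_congr rfl fun m hm => by
    rw [outcomeProb_chainMBQC hθ, (Finset.mem_filter.1 hm).2, h2], Finset.sum_const,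
    card_output_eq, nsmul_eq_mul]
  have h4 : (1 / 4 : ℝ) ^ (N + 1) = (1 / 2) ^ (N + 1) * (1 / 2) ^ (N + 1) := by
    rw [← mul_pow]; norm_num
  rw [h4]
  push_cast
  rw [one_div, inv_pow, pow_succ 2 (N + 1), pow_succ 2 N]
  field_simp

end chain

/-! ### Symmetric Boolean functions -/

/-- The number of ones in a bit string. -/
def weight {n : ℕ} (x : Fin n → ZMod 2) : ℕ := (Finset.univ.filter fun i => x i = 1).card

theorem weight_le {n : ℕ} (x : Fin n → ZMod 2) : weight x ≤ n :=
  (Finset.card_filter_le _ _).trans (by simp)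

theorem exists_perm_of_weight_eq {n : ℕ} (x y : Fin n → ZMod 2) (h : weight x = weight y) :
    ∃ σ : Equiv.Perm (Fin n), x = y ∘ σ := by
  have hcard : Fintype.card {i // x i = 1} = Fintype.card {i // y i = 1} := by
    rw [Fintype.card_subtype, Fintype.card_subtype]
    exact h
  let e := Fintype.equivOfCardEq hcard
  refine ⟨e.extendSubtype, funext fun i => ?_⟩
  have h01 : ∀ a b : ZMod 2, (a = 1 ↔ b = 1) → a = b := by decide
  apply h01
  by_cases hi : x i = 1
  · exact iff_of_true hi (e.extendSubtype_mem i hi)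
  · exact iff_of_false hi (e.extendSubtype_not_mem i hi)

theorem IsSymmetricFn.exists_weight {n : ℕ} {f : (Fin n → ZMod 2) → ZMod 2}
    (hf : IsSymmetricFn f) : ∃ g : ℕ → ZMod 2, ∀ x, f x = g (weight x) := by
  have hfac : Function.FactorsThrough f (weight (n := n)) := fun x y h => by
    obtain ⟨σ, rfl⟩ := exists_perm_of_weight_eq x y h
    exact hf σ y
  exact ⟨Function.extend weight f 0, fun x => (hfac.extend_apply 0 x).symm⟩

theorem sum_rsgn {n : ℕ} (x : Fin n → ZMod 2) : ∑ i, rsgn (x i) = n - 2 * weight x := by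
  have h1 : ∀ i, rsgn (x i) = 1 - 2 * (if x i = 1 then 1 else 0) := by
    intro i
    generalize x i = a
    revert a
    rw [forall_bit]
    constructor <;> norm_num
  simp only [h1, Finset.sum_sub_distrib, ← Finset.mul_sum, Finset.sum_boole]
  simp [weight]

/-! ### The layout of the measurement pattern -/

/-- The measurement angles: blocks of `2 n + 2` qubits, the first `n` qubits of even position
carrying the signal rotations, followed by a rotation about the `z` axis and one about the
`x` axis. -/
def patternAngle (n : ℕ) (φ ζ ξ : ℕ → ℝ) (k : ℕ) : ℝ :=
  if k % (2 * n + 2) = 2 * n + 1 then ξ (k / (2 * n + 2))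
  else if k % (2 * n + 2) = 2 * n then ζ (k / (2 * n + 2))
  else if k % (2 * n + 2) % 2 = 0 then φ (k / (2 * n + 2))
  else 0

/-- The preprocessing matrix: the `i`-th signal rotation of every block is controlled by the
`i`-th input bit. -/
def patternPre (n N : ℕ) : Matrix (Fin N) (Fin n) (ZMod 2) :=
  Matrix.of fun k i => if k.val % (2 * n + 2) = 2 * i.val then 1 else 0

/-- The positions whose angles are adapted. -/
def patternActive (n k : ℕ) : Prop :=
  k % (2 * n + 2) % 2 = 0 ∨ k % (2 * n + 2) = 2 * n + 1

instance (n : ℕ) : DecidablePred (patternActive n) := fun _ => inferInstanceAs (Decidable (_ ∨ _))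

theorem patternPre_mulVec {n N : ℕ} (x : Fin n → ZMod 2) (k : Fin N) :
    (patternPre n N *ᵥ x) k = ∑ i, if k.val % (2 * n + 2) = 2 * i.val then x i else 0 := by
  simp [Matrix.mulVec, dotProduct, patternPre]

theorem block_div {n b r : ℕ} (hr : r < 2 * n + 2) :
    (b * (2 * n + 2) + r) / (2 * n + 2) = b ∧ (b * (2 * n + 2) + r) % (2 * n + 2) = r := by
  rw [Nat.mul_comm]
  exact ⟨by rw [Nat.mul_add_div (by omega), Nat.div_eq_of_lt hr, add_zero],
    by rw [Nat.mul_add_mod, Nat.mod_eq_of_lt hr]⟩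

section pattern

variable {n N : ℕ} (φ ζ ξ : ℕ → ℝ) (x : Fin n → ZMod 2) {b : ℕ}

theorem idealAngle_signal (i : Fin n) (hN : b * (2 * n + 2) + 2 * i.val < N) :
    idealAngle (patternAngle n φ ζ ξ) (patternPre n N) x (b * (2 * n + 2) + 2 * i.val) =
      φ b * rsgn (x i) := by
  obtain ⟨h1, h2⟩ := block_div (n := n) (b := b) (r := 2 * i.val) (by omega)
  have h3 : extend (patternPre n N *ᵥ x) (b * (2 * n + 2) + 2 * i.val) = x i := by
    rw [extend, dif_pos hN, patternPre_mulVec]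
    simp only [h2]
    rw [Finset.sum_eq_single i (fun j _ hj => if_neg fun h => hj (Fin.ext (by omega)))
      (fun h => absurd (Finset.mem_univ i) h), if_pos rfl]
  have := i.isLt
  rw [idealAngle, h3, patternAngle, h1, h2, if_neg (by omega), if_neg (by omega),
    if_pos (by omega), mul_comm]

theorem idealAngle_odd {i : ℕ} (hi : i < n) :
    idealAngle (patternAngle n φ ζ ξ) (patternPre n N) x (b * (2 * n + 2) + (2 * i + 1)) = 0 := by
  obtain ⟨h1, h2⟩ := block_div (n := n) (b := b) (r := 2 * i + 1) (by omega)
  rw [idealAngle, patternAngle, h2, if_neg (by omega), if_neg (by omega), if_neg (by omega),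
    mul_zero]

theorem extend_patternPre_eq_zero {r : ℕ} (hr : 2 * n ≤ r) (hr' : r < 2 * n + 2) :
    extend (patternPre n N *ᵥ x) (b * (2 * n + 2) + r) = 0 := by
  obtain ⟨-, h2⟩ := block_div (b := b) hr'
  rw [extend]
  split_ifs with h
  · rw [patternPre_mulVec]
    simp only [h2]
    exact Finset.sum_eq_zero fun i _ => if_neg (by omega)
  · rfl

theorem idealAngle_z :
    idealAngle (patternAngle n φ ζ ξ) (patternPre n N) x (b * (2 * n + 2) + 2 * n) = ζ b := by
  obtain ⟨h1, h2⟩ := block_div (n := n) (b := b) (r := 2 * n) (by omega)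
  rw [idealAngle, extend_patternPre_eq_zero x le_rfl (by omega), patternAngle, h1, h2,
    if_neg (by omega), if_pos rfl, rsgn_zero, one_mul]

theorem idealAngle_x :
    idealAngle (patternAngle n φ ζ ξ) (patternPre n N) x (b * (2 * n + 2) + (2 * n + 1)) =
      ξ b := by
  obtain ⟨h1, h2⟩ := block_div (n := n) (b := b) (r := 2 * n + 1) (by omega)
  rw [idealAngle, extend_patternPre_eq_zero x (by omega) (by omega), patternAngle, h1, h2,
    if_pos rfl, rsgn_zero, one_mul]

/-- A zero-angle qubit after each signal qubit adds a second Hadamard, and the two multiply to 2.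
What remains is a product of commuting phases with angles φ (-1)^(x_i). -/
theorem transfer_signal (hN : b * (2 * n + 2) + 2 * n ≤ N) (v : ZMod 2 → ℂ)
    (hv : transfer (fun k => phaseVec
      (idealAngle (patternAngle n φ ζ ξ) (patternPre n N) x k)) (b * (2 * n + 2)) = v) :
    transfer (fun k => phaseVec
      (idealAngle (patternAngle n φ ζ ξ) (patternPre n N) x k)) (b * (2 * n + 2) + 2 * n) =
      (2 : ℂ) ^ n • (phaseVec (φ b * (n - 2 * weight x)) * v) := by
  have key : ∀ i ≤ n, transfer (fun k => phaseVec
      (idealAngle (patternAngle n φ ζ ξ) (patternPre n N) x k)) (b * (2 * n + 2) + 2 * i) =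
      (2 : ℂ) ^ i • (phaseVec (φ b * ∑ j ∈ Finset.range i, rsgn (extend x j)) * v) := by
    intro i
    induction i with
    | zero => simp [hv]
    | succ i ih =>
      intro hi
      rw [show b * (2 * n + 2) + 2 * (i + 1) = b * (2 * n + 2) + (2 * i + 1) + 1 by ring, transfer,
        idealAngle_odd φ ζ ξ x (by omega), phaseVec_zero, one_mul, ← add_assoc, transfer, had_had,
        ih (by omega), idealAngle_signal φ ζ ξ x ⟨i, hi⟩ (by simp only; omega),
        Finset.sum_range_succ, mul_add, phaseVec_add, extend, dif_pos (show i < n from hi),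
        mul_smul_comm, smul_smul, pow_succ', ← mul_assoc, mul_comm (phaseVec (φ b * rsgn _))]
  rw [key n le_rfl, ← sum_rsgn, ← Fin.sum_univ_eq_sum_range (fun j => rsgn (extend x j))]
  simp only [extend_val]

theorem transfer_block (hN : b * (2 * n + 2) ≤ N) : transfer (fun k => phaseVec
      (idealAngle (patternAngle n φ ζ ξ) (patternPre n N) x k)) (b * (2 * n + 2)) =
      ((2 : ℂ) ^ n) ^ b • blockState φ ζ ξ (n - 2 * weight x) b := by
  induction b with
  | zero => simp [transfer, blockState]
  | succ b ih =>
    have h1 : b * (2 * n + 2) + (2 * n + 1) + 1 = (b + 1) * (2 * n + 2) := by ring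
    rw [← h1, transfer, idealAngle_x, ← add_assoc, transfer, idealAngle_z,
      transfer_signal φ ζ ξ x (by omega) _ (ih (by omega)), blockState]
    simp only [mul_smul_comm, had_smul, smul_smul, pow_succ']

end pattern

theorem patternAngle_of_not_active (n : ℕ) (φ ζ ξ : ℕ → ℝ) (k : ℕ) (h : ¬ patternActive n k) :
    patternAngle n φ ζ ξ k = 0 := by
  unfold patternActive at h
  push Not at h
  rw [patternAngle, if_neg h.2, if_neg (fun h' => h.1 (by omega)), if_neg h.1]

theorem numClassicalBits_pattern {n N : ℕ} (M : L2MBQC n N) (hM : M.pre = patternPre n N)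
    (hN : 2 * n < N) : M.numClassicalBits = n := by
  have hrow : ∀ (k : Fin N) (i : Fin n), k.val % (2 * n + 2) = 2 * i.val →
      M.pre k = Pi.single i 1 := by
    intro k i hk
    rw [hM]
    funext j
    by_cases hij : j = i
    · subst hij; simp [patternPre, hk]
    · have : ¬ i.val = j.val := fun h => hij (Fin.ext h.symm)
      simp [patternPre, hk, hij, this]
  have himage : (Finset.univ.image fun k => M.pre k).erase 0 =
      Finset.univ.image fun i : Fin n => (Pi.single i 1 : Fin n → ZMod 2) := by
    ext p
    simp only [Finset.mem_erase, Finset.mem_image, Finset.mem_univ, true_and]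
    constructor
    · rintro ⟨hp, k, rfl⟩
      obtain ⟨i, hi⟩ := Function.ne_iff.1 hp
      have : k.val % (2 * n + 2) = 2 * i.val := by
        by_contra hne
        exact hi (by rw [hM]; exact if_neg hne)
      exact ⟨i, (hrow k i this).symm⟩
    · rintro ⟨i, rfl⟩
      have hi := i.isLt
      refine ⟨fun h => by simpa using congrFun h i, ⟨2 * i.val, by omega⟩, ?_⟩
      exact hrow _ i (Nat.mod_eq_of_lt (by simp only; omega))
  rw [L2MBQC.numClassicalBits, himage, Finset.card_image_of_injective, Finset.card_univ,
    Fintype.card_fin]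
  intro i j hij
  by_contra hne
  have := congrFun hij i
  simp [hne] at this

/-- The round in which a qubit is measured: first the qubits of angle zero at odd positions, then
alternately the rotations about the `z` and the `x` axis of each block. -/
def patternRound (n k : ℕ) : ℕ :=
  if k % (2 * n + 2) = 2 * n + 1 then 2 * (k / (2 * n + 2)) + 2
  else if k % (2 * n + 2) % 2 = 0 then 2 * (k / (2 * n + 2)) + 1 else 0

theorem patternRound_lt {n k : ℕ} (hk : k < 4 * n * (2 * n + 2) + (2 * n + 1)) :
    patternRound n k < 8 * n + 2 := by
  have h1 := Nat.div_add_mod k (2 * n + 2)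
  have h2 := Nat.mod_lt k (show 0 < 2 * n + 2 by omega)
  have h3 : k / (2 * n + 2) < 4 * n + 1 := by
    rw [Nat.div_lt_iff_lt_mul (by omega), add_mul]
    omega
  unfold patternRound
  split_ifs with h4 h5
  -- The truncated block stops before its x rotation, so these rounds end at 8n.
  · have : k / (2 * n + 2) ≠ 4 * n := by
      intro h
      rw [h, h4, mul_comm] at h1
      omega
    omega
  · omega
  · omega

/-- Byproducts link only positions of opposite parity. An even position waits for zero-angle qubits
(round 0) and x rotations of earlier blocks; an x rotation waits for even positions up to its own
block. -/
theorem patternRound_lt_of_active {n j k : ℕ} (hk : patternActive n k) (hjk : j < k)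
    (hodd : Odd (j + k)) : patternRound n j < patternRound n k := by
  have hj1 := Nat.div_add_mod j (2 * n + 2)
  have hk1 := Nat.div_add_mod k (2 * n + 2)
  have hdiv : j / (2 * n + 2) ≤ k / (2 * n + 2) := Nat.div_le_div_right hjk.le
  have hj2 : j % (2 * n + 2) % 2 = j % 2 := Nat.mod_mod_of_dvd j ⟨n + 1, by ring⟩
  have hk2 : k % (2 * n + 2) % 2 = k % 2 := Nat.mod_mod_of_dvd k ⟨n + 1, by ring⟩
  have hj3 := Nat.mod_lt j (show 0 < 2 * n + 2 by omega)
  have hk3 := Nat.mod_lt k (show 0 < 2 * n + 2 by omega)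
  have heq : j / (2 * n + 2) = k / (2 * n + 2) → j % (2 * n + 2) < k % (2 * n + 2) := by
    intro h
    rw [h] at hj1
    omega
  rw [Nat.odd_iff] at hodd
  unfold patternActive at hk
  unfold patternRound
  generalize j / (2 * n + 2) = qj at *
  generalize k / (2 * n + 2) = qk at *
  generalize j % (2 * n + 2) = rj at *
  generalize k % (2 * n + 2) = rk at *
  clear hj1 hk1
  split_ifs <;> omega

theorem exists_patternRound_eq {n : ℕ} (hn : 0 < n) (t : ℕ) (ht : t < 8 * n + 2) :
    ∃ k < 4 * n * (2 * n + 2) + (2 * n + 1), patternRound n k = t := by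
  have hle : ∀ b, b < 4 * n → b * (2 * n + 2) + (2 * n + 2) ≤ 4 * n * (2 * n + 2) := by
    intro b hb
    have := Nat.mul_le_mul_right (2 * n + 2) (Nat.succ_le_of_lt hb)
    rwa [Nat.succ_mul] at this
  rcases Nat.eq_zero_or_pos t with rfl | hpos
  · refine ⟨1, by omega, ?_⟩
    rw [patternRound, Nat.mod_eq_of_lt (by omega : 1 < 2 * n + 2), if_neg (by omega),
      if_neg (by norm_num)]
  · rcases Nat.even_or_odd' (t - 1) with ⟨b, hb | hb⟩
    · refine ⟨b * (2 * n + 2) + 0, ?_, ?_⟩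
      · have := Nat.mul_le_mul_right (2 * n + 2) (show b ≤ 4 * n by omega)
        omega
      · obtain ⟨h1, h2⟩ := block_div (n := n) (b := b) (r := 0) (by omega)
        rw [patternRound, h1, h2, if_neg (by omega), if_pos (by norm_num)]
        omega
    · refine ⟨b * (2 * n + 2) + (2 * n + 1), ?_, ?_⟩
      · have := hle b (by omega)
        omega
      · obtain ⟨h1, h2⟩ := block_div (n := n) (b := b) (r := 2 * n + 1) (by omega)
        rw [patternRound, h1, h2, if_pos rfl]
        omega

end QubitMBQC

end

/-! ### Assembly of the computation -/

open QubitMBQC in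
theorem mainTheorem7 (n : ℕ) (hn : 0 < n) (f : (Fin n → ZMod 2) → ZMod 2)
    (hf : QubitMBQC.IsSymmetricFn f) :
    ∃ M : QubitMBQC.L2MBQC n (8 * n ^ 2 + 10 * n + 1),
      M.state = QubitMBQC.clusterState (8 * n ^ 2 + 10 * n + 1) ∧
      M.Computes f ∧
      M.numClassicalBits = n ∧
      M.RunsInRounds (8 * n + 2) ∧
      QubitMBQC.PreparedInDepth M.state 3 := by
  obtain ⟨g, hg⟩ := hf.exists_weight
  obtain ⟨φ, ζ, ξ, hang⟩ := exists_angles n hn g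
  -- The chain consists of 4n full blocks and one block that ends with its z rotation, whose
  -- measurement supplies the final Hadamard.
  have hN : 8 * n ^ 2 + 10 * n + 1 = 4 * n * (2 * n + 2) + (2 * n + 1) := by ring
  refine ⟨chainMBQC (8 * n ^ 2 + 10 * n) (patternAngle n φ ζ ξ) (patternPre n _)
    (patternActive n), rfl, ?_, ?_, ?_, ?_⟩
  · refine computes_chainMBQC (patternAngle_of_not_active n φ ζ ξ) f fun x => ?_
    have h1 : ∀ c : ℕ → ZMod 2 → ℂ, transfer c (8 * n ^ 2 + 10 * n + 1) =
        had (c (4 * n * (2 * n + 2) + 2 * n) * transfer c (4 * n * (2 * n + 2) + 2 * n)) :=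
      fun c => by rw [hN, ← add_assoc]; rfl
    rw [h1, idealAngle_z, transfer_signal φ ζ ξ x (by omega) _
      (transfer_block φ ζ ξ x (by omega))]
    simp only [mul_smul_comm, had_smul, Pi.smul_apply]
    rw [hg, hang _ (weight_le x), smul_zero, smul_zero]
  · exact numClassicalBits_pattern _ rfl (by nlinarith)
  · refine ⟨fun k => ⟨patternRound n k, patternRound_lt (hN ▸ k.isLt)⟩, fun t => ?_,
      fun k j h => ?_⟩
    · obtain ⟨k, hk, hkt⟩ := exists_patternRound_eq hn t t.isLt
      exact ⟨⟨k, hN ▸ hk⟩, Fin.ext hkt⟩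
    · have h' : patternActive n k ∧ j < k ∧ Odd (j.val + k.val) := by
        by_contra hcon
        exact h (if_neg hcon)
      exact patternRound_lt_of_active h'.1 h'.2.1 h'.2.2
  · exact preparedInDepth_clusterState _ (by nlinarith)
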